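/- **Theorem 3.1.** For each integer $n\ge 2$ let $p=p(n)\in[0,1]$, and let $G(n,p)$ be the Erdős–Rényi random graph on the vertex set $[n]=\{1,\dots,n\}$, in which each of the $\binom n2$ possible edges is present independently with probability $p$. For distinct vertices $i,j$ let $S_{ij}^{(n)}$ be the number of common neighbours of $i$ and $j$, and let $T_{ij}^{(n)}$ be the number of vertices $k\in[n]\setminus\{i,j\}$ that are adjacent to at least one of $i$ and $j$. The Jaccard index of $i$ and $j$ is $$J_{ij}^{(n)}=\begin{cases} S_{ij}^{(n)}/T_{ij}^{(n)} & \text{if } T_{ij}^{(n)}>0,\\[2pt] p/(2-p) & \text{if } T_{ij}^{(n)}=0,\end{cases}$$ and the average Jaccard index of $G(n,p)$ is $$J_n=\frac{2}{n(n-1)}\sum_{i=1}^{n-1}\sum_{j=i+1}^{n}J_{ij}^{(n)}.$$ If $np\to\infty$ and $n^2(1-p)\to\infty$ as $n\to\infty$, then $$\frac{n(2-p)^2}{\sqrt{8p(1-p)}}\Big(J_n-\frac{p}{2-p}\Big)\ \longrightarrow\ Z\quad\text{in distribution},$$ where $Z$ is a standard normal random variable. -/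

import Mathlib

open MeasureTheory ProbabilityTheory Filter Topology
open scoped unitInterval

noncomputable section

/-- The union neighbourhood of the vertices `i` and `j`: the vertices other than `i` and `j`
that are adjacent to at least one of them. -/
def unionNeighbors {V : Type*} (G : SimpleGraph V) (i j : V) : Set V :=
  {k | k ≠ i ∧ k ≠ j ∧ (G.Adj i k ∨ G.Adj j k)}

open Classical in
/-- The Jaccard index of the vertices `i` and `j` of `G`: the number of common neighbours divided
by the size of the union neighbourhood, and by convention `p / (2 - p)` when the union
neighbourhood is empty (`p` is the edge probability of the random graph model). -/
def jaccardIndex {V : Type*} (p : ℝ) (G : SimpleGraph V) (i j : V) : ℝ :=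
  if (unionNeighbors G i j).ncard = 0 then p / (2 - p)
  else ((G.neighborSet i ∩ G.neighborSet j).ncard : ℝ) / ((unionNeighbors G i j).ncard : ℝ)

/-- The average of the Jaccard indices over all vertex pairs `i < j` of a graph on `n` vertices. -/
def averageJaccard (n : ℕ) (p : ℝ) (G : SimpleGraph (Fin n)) : ℝ :=
  2 / ((n : ℝ) * ((n : ℝ) - 1)) * ∑ i : Fin n, ∑ j ∈ Finset.Ioi i, jaccardIndex p G i j

end

/-! The edges are independent Bernoulli bits. Up to an error that is negligible in L², the average
Jaccard index is an affine function of the number of edges, and the central limit theorem for that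
number gives the result.

Write μ = p/(2-p), let S and T be the intersection and union sizes, and let J be the sum of the
indices over ordered pairs. Given T, each point of the union lies in the intersection with
probability μ, so S - μT has conditional mean zero. Hence every index has mean exactly μ. With the
size-bias identity for 1/(T+1), this also gives the exact mean c of the discrete derivative D_e J
along an edge (`bernExp_edgeStep`, `bernExp_edgeStepSum`).

Let f = J - c Σ_e (ω_e - p). The Efron–Stein inequality bounds Var f by p(1-p) Σ_e E (D_e f)². Since
D_e f = D_e J - E D_e J is centred, each summand is a variance, to which Efron–Stein is applied
again (`variance_edgeStepSum_le`). This needs second moments of mixed differences. For e = ik and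
the pairs containing i, about n edges at k and n edges at i contribute O((np)⁻²) each, while the n²
remaining edges contribute only O(p (np)⁻⁴). These bounds come from inverse moments of binomial
degrees and the independence of edges at different vertices. After multiplication by p the total is
O(1/(np)).

Thus Var f is at most of order n²p(1-p)/(np), smaller by the factor 1/(np) than n²p(1-p), the order
of the variance of the linear part (`bernExp_totalJaccard_sub_linear_sq_le`). The linear part is
treated by characteristic functions: the two hypotheses give n²p(1-p) → ∞, so each bit has vanishing
weight, and the normalisation makes the total variance tend to 1. -/

noncomputable section

open Function

/-! ### Independent Bernoulli bits and the Efron–Stein inequality. -/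

section BernoulliCube

set_option linter.unusedSectionVars false

variable {ι : Type*} [Fintype ι] [DecidableEq ι]

/-- The weight of a configuration of independent Bernoulli bits of parameter `p`. -/
def bernWeight (p : ℝ) (ω : ι → Bool) : ℝ := ∏ i, if ω i then p else 1 - p

/-- The expectation of `f` under independent Bernoulli bits of parameter `p`. -/
def bernExp (p : ℝ) (f : (ι → Bool) → ℝ) : ℝ := ∑ ω, bernWeight p ω * f ω

/-- The average of `f` over the bit `i`. -/
def avgAt (p : ℝ) (i : ι) (f : (ι → Bool) → ℝ) (ω : ι → Bool) : ℝ :=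
  p * f (update ω i true) + (1 - p) * f (update ω i false)

/-- The discrete derivative of `f` in the direction of the bit `i`. -/
def diffAt (i : ι) (f : (ι → Bool) → ℝ) (ω : ι → Bool) : ℝ :=
  f (update ω i true) - f (update ω i false)

/-- The `0`-`1` indicator of the bit `i`. -/
def bit (ω : ι → Bool) (i : ι) : ℝ := if ω i then 1 else 0

theorem bernWeight_nonneg {p : ℝ} (h0 : 0 ≤ p) (h1 : p ≤ 1) (ω : ι → Bool) :
    0 ≤ bernWeight p ω := by
  refine Finset.prod_nonneg fun i _ => ?_
  split_ifs <;> linarith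

theorem bernWeight_update (p : ℝ) (ω : ι → Bool) (i : ι) (b : Bool) :
    bernWeight p (update ω i b) =
      (if b then p else 1 - p) * ∏ j ∈ Finset.univ.erase i, if ω j then p else 1 - p := by
  rw [bernWeight, ← Finset.mul_prod_erase _ _ (Finset.mem_univ i)]
  congr 1
  · simp
  · refine Finset.prod_congr rfl fun j hj => ?_
    rw [update_of_ne (Finset.ne_of_mem_erase hj)]

theorem sum_update_true_add_false (i : ι) (g : (ι → Bool) → ℝ) :
    ∑ ω, (g (update ω i true) + g (update ω i false)) = 2 * ∑ ω, g ω := by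
  have hflip : ∑ ω, g (update ω i (!ω i)) = ∑ ω, g ω := by
    refine Fintype.sum_equiv ⟨fun ω => update ω i (!ω i), fun ω => update ω i (!ω i), ?_, ?_⟩ _ _
      fun ω => rfl
    · intro ω; simp
    · intro ω; simp
  have : ∀ ω : ι → Bool, g (update ω i true) + g (update ω i false)
      = g ω + g (update ω i (!ω i)) := by
    intro ω
    have h := update_eq_self i ω
    cases hb : ω i <;> rw [hb] at h <;> simp [h, add_comm]
  rw [Finset.sum_congr rfl fun ω _ => this ω, Finset.sum_add_distrib, hflip, two_mul]

/-- The tower property. Grouping each configuration with its flip at `i` makes it a termwise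
identity. -/
theorem bernExp_avgAt (p : ℝ) (i : ι) (f : (ι → Bool) → ℝ) :
    bernExp p (avgAt p i f) = bernExp p f := by
  have h1 := sum_update_true_add_false i fun ω => bernWeight p ω * avgAt p i f ω
  have h2 := sum_update_true_add_false i fun ω => bernWeight p ω * f ω
  unfold bernExp
  have : ∀ ω : ι → Bool, bernWeight p (update ω i true) * avgAt p i f (update ω i true) +
      bernWeight p (update ω i false) * avgAt p i f (update ω i false) =
      bernWeight p (update ω i true) * f (update ω i true) +
      bernWeight p (update ω i false) * f (update ω i false) := by
    intro ω
    simp only [avgAt, update_idem, bernWeight_update]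
    simp
    ring
  rw [Finset.sum_congr rfl fun ω _ => this ω, h2] at h1
  linarith

theorem bernExp_add (p : ℝ) (f g : (ι → Bool) → ℝ) :
    bernExp p (fun ω => f ω + g ω) = bernExp p f + bernExp p g := by
  simp only [bernExp, mul_add, Finset.sum_add_distrib]

theorem bernExp_sub (p : ℝ) (f g : (ι → Bool) → ℝ) :
    bernExp p (fun ω => f ω - g ω) = bernExp p f - bernExp p g := by
  simp only [bernExp, mul_sub, Finset.sum_sub_distrib]

theorem bernExp_const_mul (p c : ℝ) (f : (ι → Bool) → ℝ) :
    bernExp p (fun ω => c * f ω) = c * bernExp p f := by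
  simp only [bernExp, Finset.mul_sum]
  exact Finset.sum_congr rfl fun _ _ => by ring

theorem bernExp_sum {κ : Type*} (p : ℝ) (s : Finset κ) (f : κ → (ι → Bool) → ℝ) :
    bernExp p (fun ω => ∑ k ∈ s, f k ω) = ∑ k ∈ s, bernExp p (f k) := by
  simp only [bernExp, Finset.mul_sum]
  exact Finset.sum_comm

theorem bernExp_mono {p : ℝ} (h0 : 0 ≤ p) (h1 : p ≤ 1) {f g : (ι → Bool) → ℝ}
    (h : ∀ ω, f ω ≤ g ω) : bernExp p f ≤ bernExp p g :=
  Finset.sum_le_sum fun ω _ => mul_le_mul_of_nonneg_left (h ω) (bernWeight_nonneg h0 h1 ω)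

theorem bernExp_nonneg {p : ℝ} (h0 : 0 ≤ p) (h1 : p ≤ 1) {f : (ι → Bool) → ℝ}
    (h : ∀ ω, 0 ≤ f ω) : 0 ≤ bernExp p f :=
  Finset.sum_nonneg fun ω _ => mul_nonneg (bernWeight_nonneg h0 h1 ω) (h ω)

theorem sum_bernWeight (p : ℝ) : ∑ ω : ι → Bool, bernWeight p ω = 1 := by
  have := Finset.prod_univ_sum (fun _ : ι => (Finset.univ : Finset Bool))
    (fun _ b => if b then p else 1 - p)
  simp only [Fintype.piFinset_univ] at this
  unfold bernWeight
  rw [← this]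
  simp

theorem bernExp_const (p c : ℝ) : bernExp p (fun _ : ι → Bool => c) = c := by
  rw [bernExp, ← Finset.sum_mul, sum_bernWeight, one_mul]

theorem dependsOn_update_eq {β : Type*} {f : (ι → Bool) → β} {s : Set ι} (hf : DependsOn f s)
    {i : ι} (hi : i ∉ s) (ω : ι → Bool) (b : Bool) : f (update ω i b) = f ω :=
  hf fun j hj => update_of_ne (ne_of_mem_of_not_mem hj hi) _ _

theorem dependsOn_avgAt {p : ℝ} {i : ι} {s : Finset ι} {f : (ι → Bool) → ℝ}
    (hf : DependsOn f (insert i s : Finset ι)) : DependsOn (avgAt p i f) s := by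
  intro x y h
  have key : ∀ b, f (update x i b) = f (update y i b) := by
    intro b
    refine hf fun j hj => ?_
    by_cases hji : j = i
    · subst hji; simp
    · rw [update_of_ne hji, update_of_ne hji]
      refine h j ?_
      simpa [hji] using hj
  simp only [avgAt, key]

/-- Functions of disjoint sets of bits are uncorrelated. -/
theorem bernExp_mul {p : ℝ} {s : Finset ι} {t : Set ι} {f g : (ι → Bool) → ℝ}
    (hf : DependsOn f (s : Set ι)) (hg : DependsOn g t) (hst : ∀ i ∈ s, i ∉ t) :
    bernExp p (fun ω => f ω * g ω) = bernExp p f * bernExp p g := by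
  induction s using Finset.induction_on generalizing f with
  | empty =>
    have : f = fun _ => f (fun _ => true) := funext fun x => hf fun i hi => by simp at hi
    rw [this, bernExp_const, bernExp_const_mul]
  | insert i s _ ih =>
    have hi : i ∉ t := hst i (Finset.mem_insert_self _ _)
    -- Averaging over `i` removes it from the support of `f` and passes through `g`.
    rw [← bernExp_avgAt p i, ← bernExp_avgAt p i f,
      ← ih (dependsOn_avgAt hf) fun j hj => hst j (Finset.mem_insert_of_mem hj)]
    congr 1
    funext ω
    simp only [avgAt, dependsOn_update_eq hg hi]
    ring

/-- Averaging at `i` commutes with differencing at `j`, and the square is convex: the gap is p(1-p)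
times the squared mixed second difference. -/
theorem diffAt_avgAt_sq_le {p : ℝ} (h0 : 0 ≤ p) (h1 : p ≤ 1) {i j : ι} (hij : i ≠ j)
    (f : (ι → Bool) → ℝ) (ω : ι → Bool) :
    diffAt j (avgAt p i f) ω ^ 2 ≤ avgAt p i (fun x => diffAt j f x ^ 2) ω := by
  simp only [diffAt, avgAt, update_comm hij]
  nlinarith [mul_nonneg (mul_nonneg h0 (sub_nonneg.2 h1)) (sq_nonneg
    ((f (update (update ω j true) i true) - f (update (update ω j false) i true)) -
    (f (update (update ω j true) i false) - f (update (update ω j false) i false))))]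

theorem efronStein_finset {p : ℝ} (h0 : 0 ≤ p) (h1 : p ≤ 1) (s : Finset ι)
    (f : (ι → Bool) → ℝ) (hf : DependsOn f (s : Set ι)) :
    bernExp p (fun ω => f ω ^ 2) - bernExp p f ^ 2 ≤
      p * (1 - p) * ∑ i ∈ s, bernExp p (fun ω => diffAt i f ω ^ 2) := by
  induction s using Finset.induction_on generalizing f with
  | empty =>
    have : f = fun _ => f (fun _ => true) := funext fun x => hf fun i hi => by simp at hi
    rw [this]
    simp [bernExp_const]
  | insert i s his ih =>
    have hp : 0 ≤ p * (1 - p) := mul_nonneg h0 (sub_nonneg.2 h1)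
    have hih := ih _ (dependsOn_avgAt (p := p) hf)
    rw [bernExp_avgAt] at hih
    -- The law of total variance for one bit: a variable with the two values a and b has variance
    -- p(1-p)(a-b)².
    have hdec : bernExp p (fun ω => f ω ^ 2) = bernExp p (fun ω => avgAt p i f ω ^ 2) +
        p * (1 - p) * bernExp p (fun ω => diffAt i f ω ^ 2) := by
      rw [← bernExp_const_mul, ← bernExp_add, ← bernExp_avgAt p i]
      congr 1
      funext ω
      simp only [avgAt, diffAt]
      ring
    have hle : ∑ j ∈ s, bernExp p (fun ω => diffAt j (avgAt p i f) ω ^ 2) ≤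
        ∑ j ∈ s, bernExp p (fun ω => diffAt j f ω ^ 2) := by
      refine Finset.sum_le_sum fun j hj => ?_
      rw [← bernExp_avgAt p i fun ω => diffAt j f ω ^ 2]
      exact bernExp_mono h0 h1 fun ω => diffAt_avgAt_sq_le h0 h1 (by rintro rfl; exact his hj) f ω
    rw [Finset.sum_insert his]
    nlinarith [mul_le_mul_of_nonneg_left hle hp]

/-- The **Efron–Stein inequality** for independent Bernoulli bits. -/
theorem efronStein {p : ℝ} (h0 : 0 ≤ p) (h1 : p ≤ 1) (f : (ι → Bool) → ℝ) :
    bernExp p (fun ω => f ω ^ 2) - bernExp p f ^ 2 ≤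
      p * (1 - p) * ∑ i, bernExp p (fun ω => diffAt i f ω ^ 2) :=
  efronStein_finset h0 h1 Finset.univ f fun x y h => congrArg f (funext fun i => h i (by simp))

theorem bernExp_sq_sub_const (p c : ℝ) (f : (ι → Bool) → ℝ) (hc : bernExp p f = c) :
    bernExp p (fun ω => (f ω - c) ^ 2) = bernExp p (fun ω => f ω ^ 2) - bernExp p f ^ 2 := by
  have : (fun ω => (f ω - c) ^ 2) = fun ω => (f ω ^ 2 - 2 * c * f ω) + c ^ 2 := by
    funext ω; ring
  rw [this, bernExp_add, bernExp_sub, bernExp_const_mul, bernExp_const, hc]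
  ring

theorem bernExp_sq_le_bernExp_sq {p : ℝ} (h0 : 0 ≤ p) (h1 : p ≤ 1) (f : (ι → Bool) → ℝ) :
    bernExp p f ^ 2 ≤ bernExp p (fun ω => f ω ^ 2) := by
  have h := bernExp_sq_sub_const p _ f rfl
  have := bernExp_nonneg h0 h1 (f := fun ω => (f ω - bernExp p f) ^ 2) fun ω => sq_nonneg _
  linarith

theorem bernExp_bit (p : ℝ) (i : ι) : bernExp p (fun ω => bit ω i) = p := by
  rw [← bernExp_avgAt p i]
  have : avgAt p i (fun ω => bit ω i) = fun _ => p := by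
    funext ω; simp [avgAt, bit]
  rw [this, bernExp_const]

theorem bit_nonneg (ω : ι → Bool) (i : ι) : 0 ≤ bit ω i := by
  unfold bit; split_ifs <;> norm_num

theorem bit_sq (ω : ι → Bool) (i : ι) : bit ω i ^ 2 = bit ω i := by
  unfold bit; split_ifs <;> norm_num

theorem diffAt_bit (ω : ι → Bool) (i j : ι) :
    diffAt i (fun x => bit x j) ω = if i = j then 1 else 0 := by
  unfold diffAt bit
  by_cases h : i = j
  · subst h; simp
  · simp [update_of_ne (Ne.symm h), h]

theorem diffAt_sum {κ : Type*} (i : ι) (s : Finset κ) (f : κ → (ι → Bool) → ℝ) (ω : ι → Bool) :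
    diffAt i (fun x => ∑ k ∈ s, f k x) ω = ∑ k ∈ s, diffAt i (f k) ω := by
  simp only [diffAt, Finset.sum_sub_distrib]

theorem dependsOn_bit (i : ι) : DependsOn (fun ω : ι → Bool => bit ω i) {i} := by
  intro x y h
  simp only [bit, h i rfl]

/-- The second moment of a sum of independent Bernoulli bits. -/
theorem bernExp_sum_bit_sq_le {p : ℝ} (h0 : 0 ≤ p) (h1 : p ≤ 1) (s : Finset ι) :
    bernExp p (fun ω => (∑ i ∈ s, bit ω i) ^ 2) ≤ (s.card * p) ^ 2 + s.card * p := by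
  have h := efronStein h0 h1 fun ω : ι → Bool => ∑ i ∈ s, bit ω i
  have hE : bernExp p (fun ω : ι → Bool => ∑ i ∈ s, bit ω i) = s.card * p := by
    rw [bernExp_sum]
    simp [bernExp_bit]
  have hD : ∑ i, bernExp p (fun ω => diffAt i (fun x : ι → Bool => ∑ i ∈ s, bit x i) ω ^ 2)
      = s.card := by
    have : ∀ i, bernExp p (fun ω => diffAt i (fun x : ι → Bool => ∑ i ∈ s, bit x i) ω ^ 2)
        = if i ∈ s then 1 else 0 := by
      intro i
      simp only [diffAt_sum, diffAt_bit, Finset.sum_ite_eq, bernExp_const]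
      split_ifs <;> norm_num
    simp [this]
  rw [hE, hD] at h
  have : p * (1 - p) * (s.card : ℝ) ≤ s.card * p := by
    have : (0 : ℝ) ≤ s.card := Nat.cast_nonneg _
    nlinarith [mul_nonneg this (mul_nonneg h0 h0)]
  linarith

end BernoulliCube

/-! ### Binomial inverse moments and the joint law of intersection and union sizes. -/

section Counts

set_option linter.unusedSectionVars false

/-- The expectation of `φ` under the binomial distribution, by recursion on the number of trials. -/
def binRec (p : ℝ) : ℕ → (ℕ → ℝ) → ℝ
  | 0, φ => φ 0
  | N + 1, φ => p * binRec p N (fun k => φ (k + 1)) + (1 - p) * binRec p N φ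

theorem binRec_add (p : ℝ) (N : ℕ) (f g : ℕ → ℝ) :
    binRec p N (fun k => f k + g k) = binRec p N f + binRec p N g := by
  induction N generalizing f g with
  | zero => rfl
  | succ N ih =>
    simp only [binRec]
    rw [ih f g, ih (fun k => f (k + 1)) fun k => g (k + 1)]
    ring

theorem binRec_const_mul (p c : ℝ) (N : ℕ) (f : ℕ → ℝ) :
    binRec p N (fun k => c * f k) = c * binRec p N f := by
  induction N generalizing f with
  | zero => rfl
  | succ N ih =>
    simp only [binRec]
    rw [ih f, ih fun k => f (k + 1)]
    ring

theorem binRec_const (p c : ℝ) (N : ℕ) : binRec p N (fun _ => c) = c := by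
  induction N with
  | zero => rfl
  | succ N ih =>
    simp only [binRec, ih]
    ring

theorem binRec_mono {p : ℝ} (h0 : 0 ≤ p) (h1 : p ≤ 1) (N : ℕ) {f g : ℕ → ℝ}
    (h : ∀ k, f k ≤ g k) : binRec p N f ≤ binRec p N g := by
  induction N generalizing f g with
  | zero => exact h 0
  | succ N ih =>
    have := mul_le_mul_of_nonneg_left (ih fun k => h (k + 1)) h0
    have := mul_le_mul_of_nonneg_left (ih h) (sub_nonneg.2 h1)
    simp only [binRec]
    linarith

theorem binRec_succ_le {p : ℝ} (h0 : 0 ≤ p) (h1 : p ≤ 1) (N : ℕ) {f : ℕ → ℝ}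
    (hf : ∀ k, f (k + 1) ≤ f k) : binRec p (N + 1) f ≤ binRec p N f := by
  have := mul_le_mul_of_nonneg_left (binRec_mono h0 h1 N hf) h0
  simp only [binRec]
  linarith

/-- The size-bias identity for the binomial distribution. -/
theorem binRec_sizeBias (p : ℝ) (N : ℕ) (g : ℕ → ℝ) :
    binRec p (N + 1) (fun b => b * g b) = (N + 1) * p * binRec p N (fun b => g (b + 1)) := by
  induction N generalizing g with
  | zero => simp [binRec]
  | succ N ih =>
    rw [binRec]
    have : (fun k : ℕ => ((k + 1 : ℕ) : ℝ) * g (k + 1)) =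
        fun k : ℕ => (k : ℝ) * (fun m => g (m + 1)) k + g (k + 1) := by
      funext k; push_cast; ring
    rw [this, binRec_add, ih g, ih fun m => g (m + 1)]
    have h2 : binRec p (N + 1) (fun b => g (b + 1)) =
      p * binRec p N (fun b => g (b + 1 + 1)) + (1 - p) * binRec p N (fun b => g (b + 1)) := rfl
    rw [h2]
    push_cast
    ring

theorem binRec_indicator_zero (p : ℝ) (N : ℕ) :
    binRec p N (fun b => if b = 0 then 1 else 0) = (1 - p) ^ N := by
  induction N with
  | zero => simp [binRec]
  | succ N ih =>
    have h0 := binRec_const p 0 N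
    simp only [binRec, ih, Nat.add_eq_zero_iff, one_ne_zero, and_false, if_false, h0]
    ring

/-- Size bias with g(b) = 1/b. Since `1 / 0 = 0`, the product b · (1/b) is the indicator of b ≠ 0.
-/
theorem binRec_inv_succ (p : ℝ) (N : ℕ) :
    (N + 1) * p * binRec p N (fun b => 1 / ((b : ℝ) + 1)) = 1 - (1 - p) ^ (N + 1) := by
  have h := binRec_sizeBias p N fun b => 1 / (b : ℝ)
  push_cast at h
  rw [← h]
  have e : (fun b : ℕ => (b : ℝ) * (1 / (b : ℝ))) =
      fun b : ℕ => 1 + (-1) * (if b = 0 then 1 else 0) := by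
    funext b
    by_cases hb : b = 0
    · simp [hb]
    · have : (b : ℝ) ≠ 0 := by exact_mod_cast hb
      simp [hb, this]
  rw [e, binRec_add, binRec_const, binRec_const_mul, binRec_indicator_zero]
  ring

/-- Rising factorials suit size bias: each application trades one factor for (N+1)p and raises the
number of trials to N+1. Going back to N trials only increases the mean, because the integrand is
decreasing. -/
theorem binRec_inv_ascFactorial_le {p : ℝ} (h0 : 0 ≤ p) (h1 : p ≤ 1) (N k : ℕ) :
    ((N + 1) * p) ^ k * binRec p N (fun b => 1 / (((b + 1).ascFactorial k : ℕ) : ℝ)) ≤ 1 := by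
  have hq : 0 ≤ (N + 1 : ℝ) * p := by positivity
  induction k with
  | zero => simp [binRec_const]
  | succ k ih =>
    have h := binRec_sizeBias p N fun b => 1 / ((b.ascFactorial (k + 1) : ℕ) : ℝ)
    rw [pow_succ, mul_assoc, ← h]
    refine le_trans (mul_le_mul_of_nonneg_left ?_ (pow_nonneg hq k)) ih
    refine le_trans (binRec_mono h0 h1 (N + 1)
      (g := fun b => 1 / (((b + 1).ascFactorial k : ℕ) : ℝ)) fun b => ?_) ?_
    · have hb : b.ascFactorial (k + 1) = b * (b + 1).ascFactorial k := by
        rw [Nat.ascFactorial_succ, ← Nat.succ_ascFactorial]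
      rw [hb]
      rcases Nat.eq_zero_or_pos b with rfl | hpos
      · simp
      · have : (0 : ℝ) < b := by exact_mod_cast hpos
        have h3 : (0 : ℝ) < ((b + 1).ascFactorial k : ℕ) := by
          exact_mod_cast Nat.ascFactorial_pos b k
        push_cast
        rw [mul_one_div, div_mul_eq_div_div, div_self this.ne']
    · refine binRec_succ_le h0 h1 N fun b => ?_
      have h3 : (0 : ℝ) < ((b + 1).ascFactorial k : ℕ) := by
        exact_mod_cast Nat.ascFactorial_pos b k
      refine one_div_le_one_div_of_le h3 ?_
      exact_mod_cast Nat.ascFactorial_le k (Nat.le_succ (b + 1))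

/-- Inverse moments of the binomial distribution. -/
theorem binRec_inv_pow_le {p : ℝ} (h0 : 0 ≤ p) (h1 : p ≤ 1) (N k : ℕ) :
    ((N + 1) * p) ^ k * binRec p N (fun b => 1 / ((b : ℝ) + 1) ^ k) ≤ k.factorial := by
  have h := binRec_inv_ascFactorial_le h0 h1 N k
  have hk : (0 : ℝ) < k.factorial := by exact_mod_cast k.factorial_pos
  have hle : binRec p N (fun b => 1 / ((b : ℝ) + 1) ^ k) ≤
      k.factorial * binRec p N (fun b => 1 / (((b + 1).ascFactorial k : ℕ) : ℝ)) := by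
    rw [← binRec_const_mul]
    refine binRec_mono h0 h1 N fun b => ?_
    have h3 : (0 : ℝ) < ((b + 1).ascFactorial k : ℕ) := by
      exact_mod_cast Nat.ascFactorial_pos b k
    rw [mul_one_div, div_le_div_iff₀ (by positivity) h3, one_mul]
    exact_mod_cast Nat.ascFactorial_le_factorial_mul_pow (b + 1) k
  have := mul_le_mul_of_nonneg_left hle (show 0 ≤ ((N + 1 : ℝ) * p) ^ k by positivity)
  nlinarith

variable {ι : Type*} [Fintype ι] [DecidableEq ι]

/-- The number of bits of `s` that are set. -/
def countBits (s : Finset ι) (ω : ι → Bool) : ℕ := (s.filter fun i => ω i = true).card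

theorem countBits_insert_update {s : Finset ι} {i : ι} (hi : i ∉ s) (ω : ι → Bool) (b : Bool) :
    countBits (insert i s) (update ω i b) = countBits s ω + b.toNat := by
  have h : (s.filter fun j => update ω i b j = true) = s.filter fun j => ω j = true :=
    Finset.filter_congr fun j hj => by rw [update_of_ne (ne_of_mem_of_not_mem hj hi)]
  unfold countBits
  rw [Finset.filter_insert, h]
  cases b <;> simp [hi]

theorem dependsOn_countBits (s : Finset ι) :
    DependsOn (fun ω : ι → Bool => countBits s ω) (s : Set ι) := by
  intro x y h
  refine congrArg Finset.card (Finset.filter_congr fun i hi => ?_)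
  rw [h i (by simpa using hi)]

theorem countBits_eq_sum (s : Finset ι) (ω : ι → Bool) :
    (countBits s ω : ℝ) = ∑ i ∈ s, bit ω i := by
  simp [countBits, bit]

theorem bernExp_countBits (p : ℝ) (s : Finset ι) (φ : ℕ → ℝ) :
    bernExp p (fun ω => φ (countBits s ω)) = binRec p s.card φ := by
  induction s using Finset.induction_on generalizing φ with
  | empty => simp [countBits, binRec, bernExp_const]
  | insert i s hi ih =>
    rw [Finset.card_insert_of_notMem hi, binRec, ← ih, ← ih, ← bernExp_avgAt p i,
      ← bernExp_const_mul, ← bernExp_const_mul, ← bernExp_add]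
    congr 1
    funext ω
    simp only [avgAt, countBits_insert_update hi, Bool.toNat_true, Bool.toNat_false, add_zero]

theorem bernExp_inv_countBits_pow_le {p : ℝ} (h0 : 0 ≤ p) (h1 : p ≤ 1) (s : Finset ι) (k : ℕ) :
    ((s.card + 1) * p) ^ k * bernExp p (fun ω => 1 / ((countBits s ω : ℝ) + 1) ^ k) ≤
      k.factorial := by
  rw [bernExp_countBits p s fun b => 1 / ((b : ℝ) + 1) ^ k]
  exact binRec_inv_pow_le h0 h1 _ k

/-- The expectation of `ψ (S, T)` where `S` and `T` are the sizes of the intersection and the union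
of two independent binomial subsets of a set with `N` elements, by recursion on `N`. -/
def pairRec (p : ℝ) : ℕ → (ℕ → ℕ → ℝ) → ℝ
  | 0, ψ => ψ 0 0
  | N + 1, ψ => p ^ 2 * pairRec p N (fun a b => ψ (a + 1) (b + 1)) +
      2 * p * (1 - p) * pairRec p N (fun a b => ψ a (b + 1)) + (1 - p) ^ 2 * pairRec p N ψ

theorem pairRec_add (p : ℝ) (N : ℕ) (f g : ℕ → ℕ → ℝ) :
    pairRec p N (fun a b => f a b + g a b) = pairRec p N f + pairRec p N g := by
  induction N generalizing f g with
  | zero => rfl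
  | succ N ih =>
    simp only [pairRec]
    rw [ih f g, ih (fun a b => f a (b + 1)) fun a b => g a (b + 1),
      ih (fun a b => f (a + 1) (b + 1)) fun a b => g (a + 1) (b + 1)]
    ring

theorem pairRec_const_mul (p c : ℝ) (N : ℕ) (f : ℕ → ℕ → ℝ) :
    pairRec p N (fun a b => c * f a b) = c * pairRec p N f := by
  induction N generalizing f with
  | zero => rfl
  | succ N ih =>
    simp only [pairRec]
    rw [ih f, ih fun a b => f a (b + 1), ih fun a b => f (a + 1) (b + 1)]
    ring

/-- A point lies in the union with probability p² + 2p(1-p) = p(2-p). -/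
theorem pairRec_union (p : ℝ) (N : ℕ) (φ : ℕ → ℝ) :
    pairRec p N (fun _ b => φ b) = binRec (p * (2 - p)) N φ := by
  induction N generalizing φ with
  | zero => rfl
  | succ N ih =>
    simp only [pairRec, binRec]
    rw [ih φ, ih fun b => φ (b + 1)]
    ring

/-- Given the size `T` of the union, the size `S` of the intersection has mean `p / (2 - p) * T`. -/
theorem pairRec_inter_sub {p μ : ℝ} (hμ : μ * (2 - p) = p) (N : ℕ) (φ : ℕ → ℝ) :
    pairRec p N (fun a b => ((a : ℝ) - μ * b) * φ b) = 0 := by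
  induction N generalizing φ with
  | zero => simp [pairRec]
  | succ N ih =>
    have e1 : (fun a b : ℕ => (((a + 1 : ℕ) : ℝ) - μ * ((b + 1 : ℕ) : ℝ)) * φ (b + 1)) =
        fun a b : ℕ => ((a : ℝ) - μ * b) * (fun m => φ (m + 1)) b + (1 - μ) * φ (b + 1) := by
      funext a b; push_cast; ring
    have e2 : (fun a b : ℕ => ((a : ℝ) - μ * ((b + 1 : ℕ) : ℝ)) * φ (b + 1)) =
        fun a b : ℕ => ((a : ℝ) - μ * b) * (fun m => φ (m + 1)) b + (-μ) * φ (b + 1) := by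
      funext a b; push_cast; ring
    rw [pairRec, e1, e2, pairRec_add, pairRec_add, pairRec_const_mul, pairRec_const_mul, ih, ih]
    -- A new point contributes p²(1-μ) - 2p(1-p)μ = p(p - μ(2-p)), which vanishes by the choice of
    -- μ.
    linear_combination (-p * pairRec p N (fun _ b => φ (b + 1))) * hμ

variable {κ : Type*} [DecidableEq κ]

/-- The number of indices `x` in `s` for which both bits `u x` and `v x` are set. -/
def interCount (u v : κ → ι) (s : Finset κ) (ω : ι → Bool) : ℕ :=
  (s.filter fun x => ω (u x) = true ∧ ω (v x) = true).card

/-- The number of indices `x` in `s` for which at least one of the bits `u x` and `v x` is set. -/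
def unionCount (u v : κ → ι) (s : Finset κ) (ω : ι → Bool) : ℕ :=
  (s.filter fun x => ω (u x) = true ∨ ω (v x) = true).card

theorem interCount_insert (u v : κ → ι) {s : Finset κ} {x : κ} (hx : x ∉ s) (ω : ι → Bool) :
    interCount u v (insert x s) ω = interCount u v s ω + (ω (u x) && ω (v x)).toNat := by
  unfold interCount
  rw [Finset.filter_insert]
  cases hu : ω (u x) <;> cases hv : ω (v x) <;> simp [hx]

theorem unionCount_insert (u v : κ → ι) {s : Finset κ} {x : κ} (hx : x ∉ s) (ω : ι → Bool) :
    unionCount u v (insert x s) ω = unionCount u v s ω + (ω (u x) || ω (v x)).toNat := by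
  unfold unionCount
  rw [Finset.filter_insert]
  cases hu : ω (u x) <;> cases hv : ω (v x) <;> simp [hx]

theorem interCount_update (u v : κ → ι) {s : Finset κ} {e : ι} (he : ∀ x ∈ s, u x ≠ e ∧ v x ≠ e)
    (ω : ι → Bool) (b : Bool) : interCount u v s (update ω e b) = interCount u v s ω := by
  refine congrArg Finset.card (Finset.filter_congr fun x hx => ?_)
  rw [update_of_ne (he x hx).1, update_of_ne (he x hx).2]

theorem unionCount_update (u v : κ → ι) {s : Finset κ} {e : ι} (he : ∀ x ∈ s, u x ≠ e ∧ v x ≠ e)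
    (ω : ι → Bool) (b : Bool) : unionCount u v s (update ω e b) = unionCount u v s ω := by
  refine congrArg Finset.card (Finset.filter_congr fun x hx => ?_)
  rw [update_of_ne (he x hx).1, update_of_ne (he x hx).2]

/-- The hypotheses make all the bits `u x`, `v x` with x in `s` distinct, so averaging out the two
bits of one x reproduces one step of the recursion. -/
theorem bernExp_interCount_unionCount (p : ℝ) {u v : κ → ι} (hu : Injective u) (hv : Injective v)
    (s : Finset κ) (huv : ∀ x ∈ s, ∀ y ∈ s, u x ≠ v y) (ψ : ℕ → ℕ → ℝ) :
    bernExp p (fun ω => ψ (interCount u v s ω) (unionCount u v s ω)) = pairRec p s.card ψ := by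
  induction s using Finset.induction_on generalizing ψ with
  | empty => simp [interCount, unionCount, pairRec, bernExp_const]
  | insert x s hx ih =>
    have ih' := ih fun y hy z hz => huv y (Finset.mem_insert_of_mem hy) z
      (Finset.mem_insert_of_mem hz)
    have hxx : u x ≠ v x := huv x (Finset.mem_insert_self _ _) x (Finset.mem_insert_self _ _)
    have h1 : ∀ y ∈ s, u y ≠ u x ∧ v y ≠ u x := fun y hy =>
      ⟨fun h => ne_of_mem_of_not_mem hy hx (hu h),
        (huv x (Finset.mem_insert_self _ _) y (Finset.mem_insert_of_mem hy)).symm⟩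
    have h2 : ∀ y ∈ s, u y ≠ v x ∧ v y ≠ v x := fun y hy =>
      ⟨huv y (Finset.mem_insert_of_mem hy) x (Finset.mem_insert_self _ _),
        fun h => ne_of_mem_of_not_mem hy hx (hv h)⟩
    rw [Finset.card_insert_of_notMem hx, pairRec, ← ih', ← ih', ← ih', ← bernExp_avgAt p (v x),
      ← bernExp_avgAt p (u x), ← bernExp_const_mul, ← bernExp_const_mul, ← bernExp_const_mul,
      ← bernExp_add, ← bernExp_add]
    congr 1
    funext ω
    simp only [avgAt, interCount_insert u v hx, unionCount_insert u v hx, interCount_update u v h1,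
      interCount_update u v h2, unionCount_update u v h1, unionCount_update u v h2, update_self,
      update_of_ne hxx, Bool.toNat_true, Bool.toNat_false, Bool.and_true,
      Bool.and_false, Bool.or_true, Bool.or_false, add_zero]
    ring

end Counts

/-! ### First and second discrete derivatives of a Jaccard index. -/

section JaccardDerivative

set_option linter.unusedSectionVars false

/-- The Jaccard index of two sets with intersection of size `S` and union of size `T`, with the
value `μ` when the union is empty. -/
def jaccardValue (μ : ℝ) (S T : ℕ) : ℝ := if T = 0 then μ else (S : ℝ) / T

/-- The change of the Jaccard index when a new point is added to the first set; `b` says whether the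
point belongs to the second set. -/
def jaccardStep (μ : ℝ) (b : Bool) (S T : ℕ) : ℝ :=
  if b then 1 / ((T : ℝ) + 1) else (S : ℝ) / ((T : ℝ) + 1) - jaccardValue μ S T

theorem jaccardValue_sub (μ : ℝ) (b : Bool) (S T : ℕ) :
    jaccardValue μ (S + (true && b).toNat) (T + (true || b).toNat) -
      jaccardValue μ (S + (false && b).toNat) (T + (false || b).toNat) = jaccardStep μ b S T := by
  cases b
  · simp [jaccardStep, jaccardValue]
  · simp [jaccardStep, jaccardValue]
    ring

/-- The centred form: for μ = p/(2-p) the first term has mean zero given T. With `1 / 0 = 0` it also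
covers T = 0, so the convention for empty unions is what makes the mean exactly μ. -/
theorem jaccardValue_eq (μ : ℝ) (S T : ℕ) :
    jaccardValue μ S T = ((S : ℝ) - μ * T) * (1 / (T : ℝ)) + μ := by
  unfold jaccardValue
  split_ifs with h
  · simp [h]
  · have : (T : ℝ) ≠ 0 := by exact_mod_cast h
    field_simp
    ring

/-- The same centring for the derivative: only -μ/(T+1) survives in the mean. -/
theorem jaccardStep_false_eq (μ : ℝ) (S T : ℕ) :
    jaccardStep μ false S T =
      ((S : ℝ) - μ * T) * (1 / ((T : ℝ) + 1) - 1 / (T : ℝ)) + (-μ) * (1 / ((T : ℝ) + 1)) := by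
  have h1 : (T : ℝ) + 1 ≠ 0 := by positivity
  simp only [jaccardStep, Bool.false_eq_true, if_false, jaccardValue_eq]
  field_simp
  by_cases h : T = 0
  · simp [h]
    ring
  · have : (T : ℝ) ≠ 0 := by exact_mod_cast h
    field_simp
    ring

theorem abs_jaccardStep_true_sub_false_le {μ : ℝ} (h0 : 0 ≤ μ) (h1 : μ ≤ 1) {S T : ℕ}
    (hST : S ≤ T) : |jaccardStep μ true S T - jaccardStep μ false S T| ≤ 2 / ((T : ℝ) + 1) := by
  simp only [jaccardStep, Bool.false_eq_true, if_false, if_true]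
  by_cases h : T = 0
  · subst h
    obtain rfl : S = 0 := by omega
    simp [jaccardValue]
    rw [abs_of_nonneg (by linarith)]
    linarith
  · have hT : (0 : ℝ) < T := by exact_mod_cast Nat.pos_of_ne_zero h
    have hS : (S : ℝ) ≤ T := by exact_mod_cast hST
    have hS0 : (0 : ℝ) ≤ S := Nat.cast_nonneg S
    have e : 1 / ((T : ℝ) + 1) - ((S : ℝ) / ((T : ℝ) + 1) - jaccardValue μ S T) =
        (1 + S / T) / ((T : ℝ) + 1) := by
      simp only [jaccardValue, h, if_false]
      field_simp
      ring
    rw [e, abs_of_nonneg (by positivity)]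
    have : (S : ℝ) / T ≤ 1 := (div_le_one hT).2 hS
    gcongr
    linarith

/-- If neither new point lies in the second set, the second difference is 2S/(T(T+1)(T+2)). If
exactly one does, it is -1/((T+1)(T+2)). If both do, it vanishes, because the union does not change.
The term `p` absorbs the value μ taken at T = 0. In the mean the indicators, and S relative to T,
each supply a factor p; the count over all edges depends on it. -/
theorem abs_jaccardStep_toggle_le {μ p : ℝ} (h0 : 0 ≤ μ) (h1 : μ ≤ p) (b o : Bool) {S T : ℕ}
    (hST : S ≤ T) :
    |jaccardStep μ b (S + (true && o).toNat) (T + (true || o).toNat) -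
      jaccardStep μ b (S + (false && o).toNat) (T + (false || o).toNat)| ≤
      ((if o then 1 else 0) + (if b then 1 else 0)) / ((T : ℝ) + 1) ^ 2 +
        (4 * S + p) / ((T : ℝ) + 1) ^ 3 := by
  have hT0 : (0 : ℝ) ≤ T := Nat.cast_nonneg T
  have hS0 : (0 : ℝ) ≤ S := Nat.cast_nonneg S
  have hp : 0 ≤ p := h0.trans h1
  have hrest : 0 ≤ (4 * S + p) / ((T : ℝ) + 1) ^ 3 := by positivity
  cases o <;> cases b <;> simp [jaccardStep, jaccardValue]
  · by_cases h : T = 0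
    · subst h
      obtain rfl : S = 0 := by omega
      simpa [abs_of_nonneg h0] using h1
    · have hT : (1 : ℝ) ≤ T := by exact_mod_cast Nat.pos_of_ne_zero h
      have e : (S : ℝ) / ((T : ℝ) + 1 + 1) - S / ((T : ℝ) + 1) -
          (S / ((T : ℝ) + 1) - if T = 0 then μ else (S : ℝ) / T) =
          2 * S / (T * (T + 1) * (T + 2)) := by
        simp only [h, if_false]
        field_simp
        ring
      rw [e, abs_of_nonneg (by positivity)]
      rw [div_le_div_iff₀ (by positivity) (by positivity)]
      have : (T + 1 : ℝ) ^ 3 ≤ 2 * (T * (T + 1) * (T + 2)) := by nlinarith [mul_nonneg hT0 hT0]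
      nlinarith [mul_le_mul_of_nonneg_left this hS0, mul_nonneg hp
        (by positivity : 0 ≤ (T : ℝ) * (T + 1) * (T + 2))]
  · have e : ((T : ℝ) + 1 + 1)⁻¹ - ((T : ℝ) + 1)⁻¹ = -(1 / ((T + 1) * (T + 2))) := by
      field_simp
      ring
    rw [e, abs_neg, abs_of_nonneg (by positivity)]
    have : 1 / (((T : ℝ) + 1) * (T + 2)) ≤ (((T : ℝ) + 1) ^ 2)⁻¹ := by
      rw [← one_div]
      exact one_div_le_one_div_of_le (by positivity) (by nlinarith)
    linarith
  · have e : ((S : ℝ) + 1) / ((T : ℝ) + 1 + 1) - (S + 1) / ((T : ℝ) + 1) -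
          (S / ((T : ℝ) + 1 + 1) - S / ((T : ℝ) + 1)) = -(1 / ((T + 1) * (T + 2))) := by
      field_simp
      ring
    rw [e, abs_neg, abs_of_nonneg (by positivity)]
    have : 1 / (((T : ℝ) + 1) * (T + 2)) ≤ (((T : ℝ) + 1) ^ 2)⁻¹ := by
      rw [← one_div]
      exact one_div_le_one_div_of_le (by positivity) (by nlinarith)
    linarith
  · positivity

variable {V : Type*} [Fintype V] [DecidableEq V]

/-- The number of common neighbours of `i` and `j` in `s`. -/
abbrev commonCount (i j : V) (s : Finset V) (ω : Sym2 V → Bool) : ℕ :=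
  interCount (fun x => s(i, x)) (fun x => s(j, x)) s ω

/-- The number of vertices of `s` adjacent to at least one of `i` and `j`. -/
abbrev eitherCount (i j : V) (s : Finset V) (ω : Sym2 V → Bool) : ℕ :=
  unionCount (fun x => s(i, x)) (fun x => s(j, x)) s ω

/-- The number of neighbours of `i` in `s`. -/
def degOn (i : V) (s : Finset V) (ω : Sym2 V → Bool) : ℕ :=
  countBits (s.image fun x => s(i, x)) ω

theorem sym2_mk_injective (i : V) : Injective fun x => s(i, x) := fun _ _ h =>
  Sym2.congr_right.1 h

theorem degOn_eq_card (i : V) (s : Finset V) (ω : Sym2 V → Bool) :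
    degOn i s ω = (s.filter fun x => ω s(i, x) = true).card := by
  rw [degOn, countBits, Finset.filter_image, Finset.card_image_of_injective _ (sym2_mk_injective i)]

theorem degOn_eq_sum (i : V) (s : Finset V) (ω : Sym2 V → Bool) :
    (degOn i s ω : ℝ) = ∑ x ∈ s, bit ω s(i, x) := by
  rw [degOn, countBits_eq_sum, Finset.sum_image (sym2_mk_injective i).injOn]

theorem commonCount_eq_sum (i j : V) (s : Finset V) (ω : Sym2 V → Bool) :
    (commonCount i j s ω : ℝ) = ∑ x ∈ s, bit ω s(i, x) * bit ω s(j, x) := by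
  simp only [commonCount, interCount, bit, ← ite_and, mul_ite, mul_one, mul_zero,
    Finset.card_filter, Nat.cast_sum, Nat.cast_ite, Nat.cast_one, Nat.cast_zero]
  exact Finset.sum_congr rfl fun x _ => by simp only [and_comm]

/-- Used to replace the union size in denominators by the degree of `i`, which is independent of the
edges at `j`. -/
theorem degOn_le_eitherCount (i j : V) (s : Finset V) (ω : Sym2 V → Bool) :
    degOn i s ω ≤ eitherCount i j s ω := by
  rw [degOn_eq_card]
  exact Finset.card_le_card (Finset.monotone_filter_right _ fun x _ h => Or.inl h)

theorem commonCount_le_degOn (i j : V) (s : Finset V) (ω : Sym2 V → Bool) :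
    commonCount i j s ω ≤ degOn i s ω := by
  rw [degOn_eq_card]
  exact Finset.card_le_card (Finset.monotone_filter_right _ fun x _ h => h.1)

theorem commonCount_comm (i j : V) (s : Finset V) (ω : Sym2 V → Bool) :
    commonCount i j s ω = commonCount j i s ω := by
  simp only [commonCount, interCount, and_comm]

theorem eitherCount_comm (i j : V) (s : Finset V) (ω : Sym2 V → Bool) :
    eitherCount i j s ω = eitherCount j i s ω := by
  simp only [eitherCount, unionCount, or_comm]

/-- The Jaccard index of `i` and `j` in the graph with edge indicators `ω`. -/
def bitJaccard (μ : ℝ) (i j : V) (ω : Sym2 V → Bool) : ℝ :=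
  jaccardValue μ (commonCount i j {i, j}ᶜ ω) (eitherCount i j {i, j}ᶜ ω)

theorem bitJaccard_comm (μ : ℝ) (i j : V) (ω : Sym2 V → Bool) :
    bitJaccard μ i j ω = bitJaccard μ j i ω := by
  rw [bitJaccard, bitJaccard, commonCount_comm, eitherCount_comm, Finset.pair_comm]

/-- The derivative of the Jaccard index of `i` and `j` in the direction of the edge `ik`. -/
def edgeStep (μ : ℝ) (i k j : V) (ω : Sym2 V → Bool) : ℝ :=
  jaccardStep μ (ω s(j, k)) (commonCount i j {i, j, k}ᶜ ω) (eitherCount i j {i, j, k}ᶜ ω)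

theorem mk_ne_mk {a b c d : V} (h : ¬ ((a = c ∧ b = d) ∨ (a = d ∧ b = c))) : s(a, b) ≠ s(c, d) := by
  rwa [Ne, Sym2.eq_iff]

theorem compl_pair_eq_insert {i j k : V} (hik : i ≠ k) (hjk : j ≠ k) :
    ({i, j}ᶜ : Finset V) = insert k ({i, j, k}ᶜ : Finset V) := by
  ext x
  by_cases hx : x = k
  · subst hx; simp [hik.symm, hjk.symm]
  · simp [hx]

theorem diffAt_bitJaccard (μ : ℝ) {i j k : V} (hij : i ≠ j) (hik : i ≠ k) (hjk : j ≠ k)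
    (ω : Sym2 V → Bool) : diffAt s(i, k) (bitJaccard μ i j) ω = edgeStep μ i k j ω := by
  have hk : k ∉ ({i, j, k}ᶜ : Finset V) := by simp
  have hne : s(j, k) ≠ s(i, k) := mk_ne_mk (by grind)
  have hup : ∀ x ∈ ({i, j, k}ᶜ : Finset V), s(i, x) ≠ s(i, k) ∧ s(j, x) ≠ s(i, k) := by
    intro x hx
    simp only [Finset.mem_compl, Finset.mem_insert, Finset.mem_singleton, not_or] at hx
    exact ⟨mk_ne_mk (by grind), mk_ne_mk (by grind)⟩
  rw [edgeStep, ← jaccardValue_sub]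
  simp only [diffAt, bitJaccard, compl_pair_eq_insert hik hjk, commonCount, eitherCount,
    interCount_insert _ _ hk, unionCount_insert _ _ hk, interCount_update _ _ hup,
    unionCount_update _ _ hup, update_self, update_of_ne hne]

theorem diffAt_bitJaccard_eq_zero (μ : ℝ) {i j : V} {e : Sym2 V}
    (he : ∀ x, x ≠ i → x ≠ j → s(i, x) ≠ e ∧ s(j, x) ≠ e) (ω : Sym2 V → Bool) :
    diffAt e (bitJaccard μ i j) ω = 0 := by
  have hup : ∀ x ∈ ({i, j}ᶜ : Finset V), s(i, x) ≠ e ∧ s(j, x) ≠ e := by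
    intro x hx
    simp only [Finset.mem_compl, Finset.mem_insert, Finset.mem_singleton, not_or] at hx
    exact he x hx.1 hx.2
  simp only [diffAt, bitJaccard, commonCount, eitherCount, interCount_update _ _ hup,
    unionCount_update _ _ hup, sub_self]

theorem diffAt_edgeStep_eq_zero (μ : ℝ) {i j k : V} {e : Sym2 V} (hjk : s(j, k) ≠ e)
    (he : ∀ x, x ≠ i → x ≠ j → x ≠ k → s(i, x) ≠ e ∧ s(j, x) ≠ e) (ω : Sym2 V → Bool) :
    diffAt e (edgeStep μ i k j) ω = 0 := by
  have hup : ∀ x ∈ ({i, j, k}ᶜ : Finset V), s(i, x) ≠ e ∧ s(j, x) ≠ e := by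
    intro x hx
    simp only [Finset.mem_compl, Finset.mem_insert, Finset.mem_singleton, not_or] at hx
    exact he x hx.1 hx.2.1 hx.2.2
  simp only [diffAt, edgeStep, commonCount, eitherCount, interCount_update _ _ hup,
    unionCount_update _ _ hup, update_of_ne hjk, sub_self]

/-- The edge jk only decides whether the added point k belongs to the second set. -/
theorem abs_diffAt_edgeStep_far_le {μ : ℝ} (h0 : 0 ≤ μ) (h1 : μ ≤ 1) {i j k : V}
    (hik : i ≠ k) (ω : Sym2 V → Bool) :
    |diffAt s(j, k) (edgeStep μ i k j) ω| ≤ 2 / ((degOn i {i, j, k}ᶜ ω : ℝ) + 1) := by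
  have hup : ∀ x ∈ ({i, j, k}ᶜ : Finset V), s(i, x) ≠ s(j, k) ∧ s(j, x) ≠ s(j, k) := by
    intro x hx
    simp only [Finset.mem_compl, Finset.mem_insert, Finset.mem_singleton, not_or] at hx
    exact ⟨mk_ne_mk (by grind), mk_ne_mk (by grind)⟩
  simp only [diffAt, edgeStep, commonCount, eitherCount, interCount_update _ _ hup,
    unionCount_update _ _ hup, update_self]
  refine (abs_jaccardStep_true_sub_false_le h0 h1
    ((commonCount_le_degOn i j _ ω).trans (degOn_le_eitherCount i j _ ω))).trans ?_
  have : (degOn i {i, j, k}ᶜ ω : ℝ) ≤ eitherCount i j {i, j, k}ᶜ ω := by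
    exact_mod_cast degOn_le_eitherCount i j _ ω
  gcongr

theorem compl_triple_eq_insert {i j k x : V} (hi : x ≠ i) (hj : x ≠ j) (hk : x ≠ k) :
    ({i, j, k}ᶜ : Finset V) = insert x ({i, j, k, x}ᶜ : Finset V) := by
  ext y
  by_cases hy : y = x
  · subst hy; simp [hi, hj, hk]
  · simp [hy]

/-- The bound for the second derivatives of the Jaccard index of `i` and `j`. -/
def toggleBound (p : ℝ) (i j k x : V) (o : Sym2 V) (ω : Sym2 V → Bool) : ℝ :=
  (bit ω o + bit ω s(j, k)) / ((degOn i {i, j, k, x}ᶜ ω : ℝ) + 1) ^ 2 +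
    (4 * (commonCount i j {i, j, k, x}ᶜ ω : ℝ) + p) / ((degOn i {i, j, k, x}ᶜ ω : ℝ) + 1) ^ 3

theorem abs_diffAt_edgeStep_le {μ p : ℝ} (h0 : 0 ≤ μ) (h1 : μ ≤ p) {i j k x : V} (hij : i ≠ j)
    (hik : i ≠ k) (hjk : j ≠ k) (hxi : x ≠ i) (hxj : x ≠ j) (hxk : x ≠ k) (ω : Sym2 V → Bool) :
    |diffAt s(i, x) (edgeStep μ i k j) ω| ≤ toggleBound p i j k x s(j, x) ω ∧
    |diffAt s(j, x) (edgeStep μ i k j) ω| ≤ toggleBound p i j k x s(i, x) ω := by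
  have hx : x ∉ ({i, j, k, x}ᶜ : Finset V) := by simp
  have hmem : ∀ y ∈ ({i, j, k, x}ᶜ : Finset V), y ≠ i ∧ y ≠ j ∧ y ≠ k ∧ y ≠ x := by
    intro y hy
    simpa [not_or] using hy
  have hup : ∀ y ∈ ({i, j, k, x}ᶜ : Finset V), s(i, y) ≠ s(i, x) ∧ s(j, y) ≠ s(i, x) :=
    fun y hy => by
      have := hmem y hy
      exact ⟨mk_ne_mk (by grind), mk_ne_mk (by grind)⟩
  have hup' : ∀ y ∈ ({i, j, k, x}ᶜ : Finset V), s(i, y) ≠ s(j, x) ∧ s(j, y) ≠ s(j, x) :=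
    fun y hy => by
      have := hmem y hy
      exact ⟨mk_ne_mk (by grind), mk_ne_mk (by grind)⟩
  have e1 : s(j, k) ≠ s(i, x) := mk_ne_mk (by grind)
  have e2 : s(j, k) ≠ s(j, x) := mk_ne_mk (by grind)
  have e3 : s(j, x) ≠ s(i, x) := mk_ne_mk (by grind)
  have hST := (commonCount_le_degOn i j {i, j, k, x}ᶜ ω).trans (degOn_le_eitherCount i j _ ω)
  have hd : (degOn i {i, j, k, x}ᶜ ω : ℝ) ≤ eitherCount i j {i, j, k, x}ᶜ ω := by
    exact_mod_cast degOn_le_eitherCount i j _ ω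
  have hp : 0 ≤ p := h0.trans h1
  have hbound : ∀ o : Sym2 V, ((if ω o then 1 else 0) + (if ω s(j, k) then 1 else 0)) /
      ((eitherCount i j {i, j, k, x}ᶜ ω : ℝ) + 1) ^ 2 +
        (4 * (commonCount i j {i, j, k, x}ᶜ ω : ℝ) + p) /
          ((eitherCount i j {i, j, k, x}ᶜ ω : ℝ) + 1) ^ 3 ≤ toggleBound p i j k x o ω := by
    intro o
    have h2 := add_nonneg (bit_nonneg ω o) (bit_nonneg ω s(j, k))
    simp only [bit] at h2
    simp only [toggleBound, bit]
    gcongr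
  constructor
  · refine le_trans ?_ (hbound _)
    have := abs_jaccardStep_toggle_le h0 h1 (ω s(j, k)) (ω s(j, x)) hST
    simpa only [diffAt, edgeStep, compl_triple_eq_insert hxi hxj hxk, commonCount, eitherCount,
      interCount_insert _ _ hx, unionCount_insert _ _ hx, interCount_update _ _ hup,
      unionCount_update _ _ hup, update_self, update_of_ne e1, update_of_ne e3] using this
  -- Intersection and union are symmetric in the two bits at `x`, so toggling jx is again a
  -- one-point addition, now with ix as the fixed bit.
  · refine le_trans ?_ (hbound _)
    have := abs_jaccardStep_toggle_le h0 h1 (ω s(j, k)) (ω s(i, x)) hST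
    simpa only [diffAt, edgeStep, compl_triple_eq_insert hxi hxj hxk, commonCount, eitherCount,
      interCount_insert _ _ hx, unionCount_insert _ _ hx, interCount_update _ _ hup',
      unionCount_update _ _ hup', update_self, update_of_ne e2, update_of_ne e3.symm,
      Bool.and_comm _ (ω s(i, x)), Bool.or_comm _ (ω s(i, x)), Bool.and_comm true,
      Bool.and_comm false, Bool.or_comm true, Bool.or_comm false] using this

theorem mk_ne_mk_of_mem {i j : V} (hij : i ≠ j) {s : Finset V} (hi : i ∉ s) :
    ∀ x ∈ s, ∀ y ∈ s, s(i, x) ≠ s(j, y) := by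
  intro x hx y hy
  exact mk_ne_mk (by grind)

theorem bernExp_bitJaccard {p μ : ℝ} (hμ : μ * (2 - p) = p) {i j : V} (hij : i ≠ j) :
    bernExp p (bitJaccard μ i j) = μ := by
  have h := bernExp_interCount_unionCount p (sym2_mk_injective i) (sym2_mk_injective j)
    ({i, j}ᶜ : Finset V) (mk_ne_mk_of_mem hij (by simp)) fun a b => jaccardValue μ a b
  change bernExp p (fun ω => jaccardValue μ (commonCount i j {i, j}ᶜ ω)
    (eitherCount i j {i, j}ᶜ ω)) = μ
  rw [h]
  simp only [jaccardValue_eq]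
  rw [pairRec_add, pairRec_inter_sub hμ _ fun b => 1 / (b : ℝ), pairRec_union p _ fun _ => μ,
    binRec_const, zero_add]

/-- Averaging the bit jk and centring leave (p - (1-p)μ) E 1/(T+1) = μ E 1/(T+1), where T is
binomial with n-3 trials and parameter p(2-p). `binRec_inv_succ` evaluates this exactly, with 1 -
p(2-p) = (1-p)². -/
theorem bernExp_edgeStep {p μ : ℝ} (hμ : μ * (2 - p) = p) {i j k : V} (hij : i ≠ j)
    (hik : i ≠ k) (hjk : j ≠ k) :
    (Fintype.card V - 2) * (2 - p) ^ 2 * bernExp p (edgeStep μ i k j) =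
      1 - (1 - p) ^ (2 * (Fintype.card V - 2)) := by
  have hup : ∀ x ∈ ({i, j, k}ᶜ : Finset V), s(i, x) ≠ s(j, k) ∧ s(j, x) ≠ s(j, k) := by
    intro x hx
    simp only [Finset.mem_compl, Finset.mem_insert, Finset.mem_singleton, not_or] at hx
    exact ⟨mk_ne_mk (by grind), mk_ne_mk (by grind)⟩
  have hlaw := bernExp_interCount_unionCount p (sym2_mk_injective i) (sym2_mk_injective j)
    ({i, j, k}ᶜ : Finset V) (mk_ne_mk_of_mem hij (by simp))
  have hcard : ({i, j, k} : Finset V).card = 3 := Finset.card_eq_three.2 ⟨i, j, k, hij, hik, hjk, rfl⟩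
  have hle : 3 ≤ Fintype.card V := hcard ▸ Finset.card_le_univ _
  obtain ⟨N, hN⟩ : ∃ N, Fintype.card V = N + 3 := ⟨_, (Nat.sub_add_cancel hle).symm⟩
  have hc : ({i, j, k}ᶜ : Finset V).card = N := by rw [Finset.card_compl, hcard, hN]; rfl
  have hE : bernExp p (edgeStep μ i k j) =
      μ * binRec (p * (2 - p)) N fun b => 1 / ((b : ℝ) + 1) := by
    rw [← bernExp_avgAt p s(j, k)]
    have e : avgAt p s(j, k) (edgeStep μ i k j) = fun ω =>
        p * jaccardStep μ true (commonCount i j {i, j, k}ᶜ ω) (eitherCount i j {i, j, k}ᶜ ω) +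
        (1 - p) * jaccardStep μ false (commonCount i j {i, j, k}ᶜ ω)
          (eitherCount i j {i, j, k}ᶜ ω) := by
      funext ω
      simp only [avgAt, edgeStep, commonCount, eitherCount, interCount_update _ _ hup,
        unionCount_update _ _ hup, update_self]
    rw [e, bernExp_add, bernExp_const_mul, bernExp_const_mul,
      hlaw fun a b => jaccardStep μ true a b, hlaw fun a b => jaccardStep μ false a b, hc]
    simp only [jaccardStep_false_eq]
    rw [pairRec_add, pairRec_inter_sub hμ _ fun b => 1 / ((b : ℝ) + 1) - 1 / (b : ℝ),
      pairRec_const_mul]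
    simp only [jaccardStep, if_true]
    rw [pairRec_union p N fun b => 1 / ((b : ℝ) + 1)]
    linear_combination (-binRec (p * (2 - p)) N fun b => 1 / ((b : ℝ) + 1)) * hμ
  have hB := binRec_inv_succ (p * (2 - p)) N
  have hpow : (1 - p) ^ (2 * (Fintype.card V - 2)) = (1 - p * (2 - p)) ^ (N + 1) := by
    rw [hN, show N + 3 - 2 = N + 1 by omega, pow_mul]
    congr 1
    ring
  rw [hpow, ← hB, hE, hN]
  push_cast
  linear_combination ((N + 1 : ℝ) * (2 - p) *
    binRec (p * (2 - p)) N fun b => 1 / ((b : ℝ) + 1)) * hμ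

end JaccardDerivative

/-! ### Second moments of the second-derivative bound. -/

section VarianceBound

set_option linter.unusedSectionVars false

variable {V : Type*} [Fintype V] [DecidableEq V]

theorem dependsOn_degOn (i : V) (s : Finset V) :
    DependsOn (fun ω : Sym2 V → Bool => degOn i s ω)
      ((s.image fun x => s(i, x) : Finset (Sym2 V)) : Set (Sym2 V)) :=
  dependsOn_countBits _

theorem bernExp_inv_degOn_pow_le {p : ℝ} (h0 : 0 ≤ p) (h1 : p ≤ 1) (i : V) (s : Finset V) (k : ℕ) :
    ((s.card + 1) * p) ^ k * bernExp p (fun ω => 1 / ((degOn i s ω : ℝ) + 1) ^ k) ≤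
      k.factorial := by
  have h := bernExp_inv_countBits_pow_le h0 h1 (s.image fun x => s(i, x)) k
  rwa [Finset.card_image_of_injective _ (sym2_mk_injective i)] at h

theorem bernExp_inv_degOn_pow_le_div {p K : ℝ} (h0 : 0 ≤ p) (h1 : p ≤ 1) (hK : 0 < K) (i : V)
    {s : Finset V} (hs : K ≤ (s.card + 1) * p) (k : ℕ) :
    bernExp p (fun ω => 1 / ((degOn i s ω : ℝ) + 1) ^ k) ≤ k.factorial / K ^ k := by
  rw [le_div_iff₀ (by positivity), mul_comm]
  refine le_trans ?_ (bernExp_inv_degOn_pow_le h0 h1 i s k)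
  refine mul_le_mul_of_nonneg_right (pow_le_pow_left₀ hK.le hs k) ?_
  exact bernExp_nonneg h0 h1 fun ω => by positivity

/-- Functions of the neighbours of `i` in `s` are uncorrelated with functions of other bits. -/
theorem bernExp_mul_degOn (p : ℝ) {i : V} {s : Finset V} {t : Set (Sym2 V)}
    (ht : ∀ x ∈ s, s(i, x) ∉ t) {f g : (Sym2 V → Bool) → ℝ}
    (hf : DependsOn f ((s.image fun x => s(i, x) : Finset (Sym2 V)) : Set (Sym2 V)))
    (hg : DependsOn g t) : bernExp p (fun ω => f ω * g ω) = bernExp p f * bernExp p g := by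
  refine bernExp_mul hf hg fun e he => ?_
  obtain ⟨x, hx, rfl⟩ := Finset.mem_image.1 he
  exact ht x hx

theorem dependsOn_comp_degOn (i : V) (s : Finset V) (φ : ℕ → ℝ) :
    DependsOn (fun ω : Sym2 V → Bool => φ (degOn i s ω))
      ((s.image fun x => s(i, x) : Finset (Sym2 V)) : Set (Sym2 V)) :=
  fun _ _ h => congrArg φ (dependsOn_degOn i s h)

theorem dependsOn_bit_mul_degOn (i : V) {s : Finset V} {y : V} (hy : y ∈ s) (φ : ℕ → ℝ) :
    DependsOn (fun ω : Sym2 V → Bool => bit ω s(i, y) * φ (degOn i s ω))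
      ((s.image fun x => s(i, x) : Finset (Sym2 V)) : Set (Sym2 V)) := by
  intro ω ω' h
  have h1 : bit ω s(i, y) = bit ω' s(i, y) :=
    dependsOn_bit s(i, y) fun e he => h e (by
      rw [Set.mem_singleton_iff.1 he]
      exact Finset.mem_coe.2 (Finset.mem_image_of_mem _ hy))
  simp only [h1, dependsOn_comp_degOn i s φ h]

theorem bernExp_bit_mul_degOn (p : ℝ) {i : V} {s : Finset V} {e : Sym2 V}
    (he : ∀ x ∈ s, s(i, x) ≠ e) (φ : ℕ → ℝ) :
    bernExp p (fun ω => bit ω e * φ (degOn i s ω)) =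
      p * bernExp p (fun ω => φ (degOn i s ω)) := by
  have h := bernExp_mul_degOn p (t := {e}) (fun x hx => he x hx) (dependsOn_comp_degOn i s φ)
    (dependsOn_bit e)
  rw [bernExp_bit] at h
  rw [mul_comm p, ← h]
  simp only [mul_comm]

/-- Given the edges at `i`, each neighbour of `i` in `s` is joined to `j` with probability p. -/
theorem bernExp_commonCount_mul_degOn (p : ℝ) {i j : V} (hij : i ≠ j) {s : Finset V} (hj : j ∉ s)
    (φ : ℕ → ℝ) :
    bernExp p (fun ω => (commonCount i j s ω : ℝ) * φ (degOn i s ω)) =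
      p * bernExp p (fun ω => (degOn i s ω : ℝ) * φ (degOn i s ω)) := by
  simp only [commonCount_eq_sum, degOn_eq_sum i s, Finset.sum_mul]
  rw [bernExp_sum, bernExp_sum, Finset.mul_sum]
  refine Finset.sum_congr rfl fun y hy => ?_
  have h := bernExp_mul_degOn p (t := {s(j, y)}) (fun x hx => mk_ne_mk (by grind))
    (dependsOn_bit_mul_degOn i hy φ) (dependsOn_bit s(j, y))
  rw [bernExp_bit, mul_comm] at h
  rw [← h]
  congr 1
  funext ω
  ring

/-- Idempotence of bits, S² ≤ S(d+1) and p² ≤ p make the bound linear in the bits, in S and in p, so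
that every term yields a factor p in the mean. -/
theorem toggleBound_sq_le {p : ℝ} (h0 : 0 ≤ p) (h1 : p ≤ 1) (i j k x : V) (o : Sym2 V)
    (ω : Sym2 V → Bool) :
    toggleBound p i j k x o ω ^ 2 ≤
      (4 * (bit ω o * (1 / ((degOn i {i, j, k, x}ᶜ ω : ℝ) + 1) ^ 4)) +
        4 * (bit ω s(j, k) * (1 / ((degOn i {i, j, k, x}ᶜ ω : ℝ) + 1) ^ 4))) +
      (64 * ((commonCount i j {i, j, k, x}ᶜ ω : ℝ) *
        (1 / ((degOn i {i, j, k, x}ᶜ ω : ℝ) + 1) ^ 5)) +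
        4 * p * (1 / ((degOn i {i, j, k, x}ᶜ ω : ℝ) + 1) ^ 4)) := by
  set s : Finset V := {i, j, k, x}ᶜ
  set d : ℝ := (degOn i s ω : ℝ)
  set S : ℝ := (commonCount i j s ω : ℝ)
  have hd : 0 ≤ d := Nat.cast_nonneg _
  have hS : 0 ≤ S := Nat.cast_nonneg _
  have hSd : S ≤ d := Nat.cast_le.2 (commonCount_le_degOn i j s ω)
  have hb1 := bit_nonneg ω o
  have hb2 := bit_nonneg ω s(j, k)
  have hs1 := bit_sq ω o
  have hs2 := bit_sq ω s(j, k)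
  have hD : 0 < d + 1 := by linarith
  have e1 : toggleBound p i j k x o ω ^ 2 ≤
      2 * ((bit ω o + bit ω s(j, k)) / (d + 1) ^ 2) ^ 2 +
      2 * ((4 * S + p) / (d + 1) ^ 3) ^ 2 := by
    have : ∀ a b : ℝ, (a + b) ^ 2 ≤ 2 * a ^ 2 + 2 * b ^ 2 := fun a b => by
      nlinarith [sq_nonneg (a - b)]
    exact this _ _
  have e2 : ((bit ω o + bit ω s(j, k)) / (d + 1) ^ 2) ^ 2 ≤
      (2 * bit ω o + 2 * bit ω s(j, k)) * (1 / (d + 1) ^ 4) := by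
    rw [div_pow, ← pow_mul, mul_one_div]
    gcongr
    nlinarith [sq_nonneg (bit ω o - bit ω s(j, k))]
  have e3 : ((4 * S + p) / (d + 1) ^ 3) ^ 2 ≤
      32 * (S * (1 / (d + 1) ^ 5)) + 2 * p * (1 / (d + 1) ^ 4) := by
    have hp2 : p ^ 2 ≤ p := by nlinarith
    have hn : (4 * S + p) ^ 2 ≤ 32 * S * (d + 1) + 2 * p * (d + 1) ^ 2 := by
      have h5 : S ^ 2 ≤ S * (d + 1) := by nlinarith
      have h6 : p ≤ p * (d + 1) ^ 2 := by nlinarith [mul_nonneg h0 hd, mul_nonneg h0 (sq_nonneg d)]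
      nlinarith [sq_nonneg (4 * S - p)]
    have e4 : 32 * (S * (1 / (d + 1) ^ 5)) + 2 * p * (1 / (d + 1) ^ 4) =
        (32 * S * (d + 1) + 2 * p * (d + 1) ^ 2) / (d + 1) ^ 6 := by
      field_simp
    rw [e4, div_pow, ← pow_mul]
    gcongr
  linarith

theorem bernExp_toggleBound_sq_le {p K : ℝ} (h0 : 0 ≤ p) (h1 : p ≤ 1) (hK : 0 < K)
    {i j k x : V} (hij : i ≠ j)
    (hcard : K ≤ ((({i, j, k, x}ᶜ : Finset V).card : ℝ) + 1) * p) {o : Sym2 V}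
    (ho : o = s(i, x) ∨ o = s(j, x)) :
    bernExp p (fun ω => toggleBound p i j k x o ω ^ 2) ≤ 1824 * p / K ^ 4 := by
  refine (bernExp_mono h0 h1 (toggleBound_sq_le h0 h1 i j k x o)).trans ?_
  set s : Finset V := {i, j, k, x}ᶜ with hs
  have hmem : ∀ y ∈ s, y ≠ i ∧ y ≠ j ∧ y ≠ k ∧ y ≠ x := by
    intro y hy
    simpa [hs, not_or] using hy
  have h4 := bernExp_inv_degOn_pow_le_div h0 h1 hK i hcard 4
  have ho' : ∀ y ∈ s, s(i, y) ≠ o := by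
    intro y hy
    have := hmem y hy
    rcases ho with rfl | rfl <;> exact mk_ne_mk (by grind)
  have hjk' : ∀ y ∈ s, s(i, y) ≠ s(j, k) := by
    intro y hy
    have := hmem y hy
    exact mk_ne_mk (by grind)
  rw [bernExp_add, bernExp_add, bernExp_add, bernExp_const_mul, bernExp_const_mul,
    bernExp_const_mul, bernExp_const_mul,
    bernExp_bit_mul_degOn p ho' fun d => 1 / ((d : ℝ) + 1) ^ 4,
    bernExp_bit_mul_degOn p hjk' fun d => 1 / ((d : ℝ) + 1) ^ 4,
    bernExp_commonCount_mul_degOn p hij (by simp [hs]) fun d => 1 / ((d : ℝ) + 1) ^ 5]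
  have h5 : bernExp p (fun ω => (degOn i s ω : ℝ) * (1 / ((degOn i s ω : ℝ) + 1) ^ 5)) ≤
      bernExp p (fun ω => 1 / ((degOn i s ω : ℝ) + 1) ^ 4) := by
    refine bernExp_mono h0 h1 fun ω => ?_
    have hd : (0 : ℝ) ≤ degOn i s ω := Nat.cast_nonneg _
    rw [mul_one_div, div_le_div_iff₀ (by positivity) (by positivity), one_mul, pow_succ _ 4,
      mul_comm]
    gcongr
    linarith
  set E := bernExp p (fun ω => 1 / ((degOn i s ω : ℝ) + 1) ^ 4)
  have h7 : p * E ≤ p * (24 / K ^ 4) := by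
    refine mul_le_mul_of_nonneg_left ?_ h0
    simpa [Nat.factorial] using h4
  have h8 := mul_le_mul_of_nonneg_left h5 h0
  -- 76 = 4 + 4 + 64 + 4 collects the four terms, and 24 = 4! is the constant of the fourth inverse
  -- moment.
  have h9 : 1824 * p / K ^ 4 = 76 * (p * (24 / K ^ 4)) := by ring
  rw [h9]
  linarith

end VarianceBound

/-! ### Mixed differences of the total derivative, by the position of the second edge. -/

section VarianceBound

set_option linter.unusedSectionVars false

variable {V : Type*} [Fintype V] [DecidableEq V]

/-- The part of the derivative in the direction of `ik` of the sum of all Jaccard indices that comes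
from the pairs containing `i`. -/
def edgeStepSum (μ : ℝ) (i k : V) (ω : Sym2 V → Bool) : ℝ :=
  ∑ j ∈ ({i, k}ᶜ : Finset V), edgeStep μ i k j ω

theorem mem_compl_pair {i k j : V} : j ∈ ({i, k}ᶜ : Finset V) ↔ j ≠ i ∧ j ≠ k := by
  simp

/-- Of all the summands only the one indexed by this `j` sees the edge jk. -/
theorem bernExp_diffAt_edgeStepSum_far_le {p μ K : ℝ} (h0 : 0 ≤ p) (h1 : p ≤ 1) (hμ0 : 0 ≤ μ)
    (hμ1 : μ ≤ 1) (hK : 0 < K) (hcard : K ≤ (Fintype.card V - 3) * p) {i k j : V} (hik : i ≠ k)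
    (hji : j ≠ i) (hjk : j ≠ k) :
    bernExp p (fun ω => diffAt s(j, k) (edgeStepSum μ i k) ω ^ 2) ≤ 8 / K ^ 2 := by
  have hd : ∀ ω, diffAt s(j, k) (edgeStepSum μ i k) ω = diffAt s(j, k) (edgeStep μ i k j) ω := by
    intro ω
    have h := diffAt_sum s(j, k) ({i, k}ᶜ : Finset V) (fun j' => edgeStep μ i k j') ω
    change diffAt s(j, k) (fun x => ∑ j' ∈ ({i, k}ᶜ : Finset V), edgeStep μ i k j' x) ω = _
    rw [h]
    refine Finset.sum_eq_single_of_mem j (mem_compl_pair.2 ⟨hji, hjk⟩) fun j' hj' hne => ?_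
    obtain ⟨h1, h2⟩ := mem_compl_pair.1 hj'
    exact diffAt_edgeStep_eq_zero μ (mk_ne_mk (by grind))
      (fun x _ _ _ => ⟨mk_ne_mk (by grind), mk_ne_mk (by grind)⟩) ω
  have hc : ({i, j, k} : Finset V).card ≤ 3 := Finset.card_le_three
  have hcard' : K ≤ ((({i, j, k}ᶜ : Finset V).card : ℝ) + 1) * p := by
    refine hcard.trans (mul_le_mul_of_nonneg_right ?_ h0)
    have := Finset.card_compl_add_card ({i, j, k} : Finset V)
    have h3 : Fintype.card V ≤ ({i, j, k}ᶜ : Finset V).card + 3 := by omega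
    have : (Fintype.card V : ℝ) ≤ (({i, j, k}ᶜ : Finset V).card : ℝ) + 3 := by exact_mod_cast h3
    linarith
  have h2 := bernExp_inv_degOn_pow_le_div h0 h1 hK i hcard' 2
  calc bernExp p (fun ω => diffAt s(j, k) (edgeStepSum μ i k) ω ^ 2)
      ≤ bernExp p (fun ω => 4 * (1 / ((degOn i {i, j, k}ᶜ ω : ℝ) + 1) ^ 2)) := by
        refine bernExp_mono h0 h1 fun ω => ?_
        rw [hd]
        have h := abs_diffAt_edgeStep_far_le hμ0 hμ1 (j := j) hik ω
        calc diffAt s(j, k) (edgeStep μ i k j) ω ^ 2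
            = |diffAt s(j, k) (edgeStep μ i k j) ω| ^ 2 := (sq_abs _).symm
          _ ≤ (2 / ((degOn i {i, j, k}ᶜ ω : ℝ) + 1)) ^ 2 := by gcongr
          _ = _ := by rw [div_pow]; ring
    _ = 4 * bernExp p (fun ω => 1 / ((degOn i {i, j, k}ᶜ ω : ℝ) + 1) ^ 2) := bernExp_const_mul ..
    _ ≤ 4 * (2 / K ^ 2) := by
        refine mul_le_mul_of_nonneg_left ?_ (by norm_num)
        simpa [Nat.factorial] using h2
    _ = 8 / K ^ 2 := by ring

theorem card_compl_quadruple_le {p K : ℝ} (h0 : 0 ≤ p) (hcard : K ≤ (Fintype.card V - 3) * p)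
    (i j k x : V) : K ≤ ((({i, j, k, x}ᶜ : Finset V).card : ℝ) + 1) * p := by
  refine hcard.trans (mul_le_mul_of_nonneg_right ?_ h0)
  have := Finset.card_compl_add_card ({i, j, k, x} : Finset V)
  have hc : ({i, j, k, x} : Finset V).card ≤ 4 := Finset.card_le_four
  have h3 : Fintype.card V ≤ ({i, j, k, x}ᶜ : Finset V).card + 4 := by omega
  have : (Fintype.card V : ℝ) ≤ (({i, j, k, x}ᶜ : Finset V).card : ℝ) + 4 := by exact_mod_cast h3
  linarith

/-- An edge jx avoiding `i` and `k` is seen only by the summands `j` and `x`. The factor p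
compensates for the order n² number of such edges. -/
theorem bernExp_diffAt_edgeStepSum_generic_le {p μ K : ℝ} (h0 : 0 ≤ p) (h1 : p ≤ 1) (hμ0 : 0 ≤ μ)
    (hμ1 : μ ≤ p) (hK : 0 < K) (hcard : K ≤ (Fintype.card V - 3) * p) {i k j x : V} (hik : i ≠ k)
    (hji : j ≠ i) (hjk : j ≠ k) (hxi : x ≠ i) (hxk : x ≠ k) (hjx : j ≠ x) :
    bernExp p (fun ω => diffAt s(j, x) (edgeStepSum μ i k) ω ^ 2) ≤ 7296 * p / K ^ 4 := by
  have hd : ∀ ω, diffAt s(j, x) (edgeStepSum μ i k) ω =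
      diffAt s(j, x) (edgeStep μ i k j) ω + diffAt s(j, x) (edgeStep μ i k x) ω := by
    intro ω
    have h := diffAt_sum s(j, x) ({i, k}ᶜ : Finset V) (fun j' => edgeStep μ i k j') ω
    change diffAt s(j, x) (fun y => ∑ j' ∈ ({i, k}ᶜ : Finset V), edgeStep μ i k j' y) ω = _
    rw [h, ← Finset.sum_pair (f := fun y => diffAt s(j, x) (edgeStep μ i k y) ω) hjx]
    symm
    refine Finset.sum_subset ?_ fun j' hj' hne => ?_
    · intro y hy
      simp only [Finset.mem_insert, Finset.mem_singleton] at hy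
      rcases hy with rfl | rfl
      · exact mem_compl_pair.2 ⟨hji, hjk⟩
      · exact mem_compl_pair.2 ⟨hxi, hxk⟩
    · obtain ⟨h1, h2⟩ := mem_compl_pair.1 hj'
      simp only [Finset.mem_insert, Finset.mem_singleton, not_or] at hne
      exact diffAt_edgeStep_eq_zero μ (mk_ne_mk (by grind))
        (fun y _ _ _ => ⟨mk_ne_mk (by grind), mk_ne_mk (by grind)⟩) ω
  have hb1 := bernExp_toggleBound_sq_le h0 h1 hK (i := i) (j := j) (k := k) (x := x) hji.symm
    (card_compl_quadruple_le h0 hcard i j k x) (o := s(i, x)) (Or.inl rfl)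
  have hb2 := bernExp_toggleBound_sq_le h0 h1 hK (i := i) (j := x) (k := k) (x := j) hxi.symm
    (card_compl_quadruple_le h0 hcard i x k j) (o := s(i, j)) (Or.inl rfl)
  calc bernExp p (fun ω => diffAt s(j, x) (edgeStepSum μ i k) ω ^ 2)
      ≤ bernExp p (fun ω => 2 * toggleBound p i j k x s(i, x) ω ^ 2 +
          2 * toggleBound p i x k j s(i, j) ω ^ 2) := by
        refine bernExp_mono h0 h1 fun ω => ?_
        have ha := (abs_diffAt_edgeStep_le hμ0 hμ1 hji.symm hik hjk hxi hjx.symm hxk ω).2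
        have hb := (abs_diffAt_edgeStep_le hμ0 hμ1 hxi.symm hik hxk hji hjx hjk ω).2
        rw [Sym2.eq_swap (a := x)] at hb
        rw [hd]
        have ha' := sq_le_sq' (abs_le.1 ha).1 (abs_le.1 ha).2
        have hb' := sq_le_sq' (abs_le.1 hb).1 (abs_le.1 hb).2
        nlinarith [sq_nonneg (diffAt s(j, x) (edgeStep μ i k j) ω -
          diffAt s(j, x) (edgeStep μ i k x) ω)]
    _ = 2 * bernExp p (fun ω => toggleBound p i j k x s(i, x) ω ^ 2) +
          2 * bernExp p (fun ω => toggleBound p i x k j s(i, j) ω ^ 2) := by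
        rw [bernExp_add, bernExp_const_mul, bernExp_const_mul]
    _ ≤ 2 * (1824 * p / K ^ 4) + 2 * (1824 * p / K ^ 4) := by gcongr
    _ = 7296 * p / K ^ 4 := by ring

/-- Makes the denominators independent of `j`, so that the bounds can be summed over `j`. Restoring
`j` raises the degree d by at most one and so costs a factor 2 in d+1; hence 4 = 2², 32 = 4·2³ and 8
= 2³. -/
theorem toggleBound_le {p : ℝ} (h0 : 0 ≤ p) {i j k l : V} (hij : i ≠ j) (hjk : j ≠ k) (hjl : j ≠ l)
    (ω : Sym2 V → Bool) :
    toggleBound p i j k l s(j, l) ω ≤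
      4 * (bit ω s(l, j) + bit ω s(k, j)) / ((degOn i {i, k, l}ᶜ ω : ℝ) + 1) ^ 2 +
      (32 * (commonCount i j (({i, k, l}ᶜ : Finset V).erase j) ω : ℝ) + 8 * p) /
        ((degOn i {i, k, l}ᶜ ω : ℝ) + 1) ^ 3 := by
  have hs : ({i, j, k, l}ᶜ : Finset V) = ({i, k, l}ᶜ : Finset V).erase j := by
    ext y
    simp only [Finset.mem_compl, Finset.mem_insert, Finset.mem_singleton, Finset.mem_erase]
    tauto
  have hj : j ∈ ({i, k, l}ᶜ : Finset V) := by simp [hij.symm, hjk, hjl]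
  rw [toggleBound, hs, Sym2.eq_swap (a := j) (b := l), Sym2.eq_swap (a := j) (b := k)]
  set s : Finset V := {i, k, l}ᶜ
  have hle : (degOn i s ω : ℝ) ≤ degOn i (s.erase j) ω + 1 := by
    rw [degOn_eq_sum, degOn_eq_sum, ← Finset.sum_erase_add _ _ hj]
    have : bit ω s(i, j) ≤ 1 := by unfold bit; split_ifs <;> norm_num
    linarith
  have hd0 : (0 : ℝ) ≤ degOn i (s.erase j) ω := Nat.cast_nonneg _
  have hd1 : (0 : ℝ) ≤ degOn i s ω := Nat.cast_nonneg _
  set a : ℝ := (degOn i (s.erase j) ω : ℝ)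
  set d : ℝ := (degOn i s ω : ℝ)
  have hb1 := bit_nonneg ω s(l, j)
  have hb2 := bit_nonneg ω s(k, j)
  have hS : (0 : ℝ) ≤ commonCount i j (s.erase j) ω := Nat.cast_nonneg _
  have hkey : (d + 1) / 2 ≤ a + 1 := by linarith
  have hpos : 0 < (d + 1) / 2 := by linarith
  refine add_le_add ?_ ?_
  · calc (bit ω s(l, j) + bit ω s(k, j)) / (a + 1) ^ 2
        ≤ (bit ω s(l, j) + bit ω s(k, j)) / ((d + 1) / 2) ^ 2 := by gcongr
      _ = _ := by field_simp; ring
  · calc (4 * (commonCount i j (s.erase j) ω : ℝ) + p) / (a + 1) ^ 3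
        ≤ (4 * (commonCount i j (s.erase j) ω : ℝ) + p) / ((d + 1) / 2) ^ 3 := by gcongr
      _ = _ := by field_simp; ring

/-- The sum counts paths i–y–j; ordering them by the middle vertex gives a sum of degrees over
neighbours of `i`, and Cauchy–Schwarz applies. For `i` outside `s` the inner degrees are independent
of the edges at `i`. -/
theorem sum_commonCount_sq_le (i : V) (s : Finset V) (ω : Sym2 V → Bool) :
    (∑ j ∈ s, (commonCount i j (s.erase j) ω : ℝ)) ^ 2 ≤
      (degOn i s ω : ℝ) * ∑ y ∈ s, bit ω s(i, y) * (degOn y (s.erase y) ω : ℝ) ^ 2 := by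
  have h : ∑ j ∈ s, (commonCount i j (s.erase j) ω : ℝ) =
      ∑ y ∈ s, bit ω s(i, y) * (bit ω s(i, y) * (degOn y (s.erase y) ω : ℝ)) := by
    simp only [commonCount_eq_sum, ← mul_assoc, ← sq, bit_sq, degOn_eq_sum, Finset.mul_sum]
    rw [Finset.sum_comm' (t' := s) (s' := fun y => s.erase y)
      (by intro x y; simp only [Finset.mem_erase]; tauto)]
    exact Finset.sum_congr rfl fun y _ => Finset.sum_congr rfl fun j _ => by
      rw [Sym2.eq_swap (a := j)]
  rw [h]
  refine (Finset.sum_mul_sq_le_sq_mul_sq _ _ _).trans_eq ?_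
  simp only [mul_pow, bit_sq]
  rw [degOn_eq_sum i]

/-- The edge il affects every pair {i, j} with j ≠ l. Summed over j, the bits become the degrees of
`l` and `k`, and the common counts become a path count. -/
theorem abs_diffAt_edgeStepSum_near_le {p μ : ℝ} (h0 : 0 ≤ p) (hμ0 : 0 ≤ μ) (hμ1 : μ ≤ p)
    {i k l : V} (hik : i ≠ k) (hli : l ≠ i) (hlk : l ≠ k) (ω : Sym2 V → Bool) :
    |diffAt s(i, l) (edgeStepSum μ i k) ω| ≤
      4 * ((degOn l {i, k, l}ᶜ ω : ℝ) + degOn k {i, k, l}ᶜ ω) /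
        ((degOn i {i, k, l}ᶜ ω : ℝ) + 1) ^ 2 +
      (32 * (∑ j ∈ ({i, k, l}ᶜ : Finset V),
        (commonCount i j (({i, k, l}ᶜ : Finset V).erase j) ω : ℝ)) + 8 * (Fintype.card V * p)) /
        ((degOn i {i, k, l}ᶜ ω : ℝ) + 1) ^ 3 := by
  have h := diffAt_sum s(i, l) ({i, k}ᶜ : Finset V) (fun j' => edgeStep μ i k j') ω
  change |diffAt s(i, l) (fun y => ∑ j' ∈ ({i, k}ᶜ : Finset V), edgeStep μ i k j' y) ω| ≤ _
  have hl : l ∉ ({i, k, l}ᶜ : Finset V) := by simp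
  have hmem : ∀ y ∈ ({i, k, l}ᶜ : Finset V), y ≠ i ∧ y ≠ k ∧ y ≠ l := by
    intro y hy
    simpa [not_or] using hy
  have hzero : diffAt s(i, l) (edgeStep μ i k l) ω = 0 :=
    diffAt_edgeStep_eq_zero μ (mk_ne_mk (by grind))
      (fun y _ _ _ => ⟨mk_ne_mk (by grind), mk_ne_mk (by grind)⟩) ω
  rw [h, compl_pair_eq_insert hli.symm hlk.symm, Finset.sum_insert hl, hzero, zero_add]
  refine (Finset.abs_sum_le_sum_abs _ _).trans ?_
  refine (Finset.sum_le_sum fun j hj => ((abs_diffAt_edgeStep_le hμ0 hμ1 (hmem j hj).1.symm hik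
    (hmem j hj).2.1 hli (hmem j hj).2.2.symm hlk ω).1.trans (toggleBound_le h0 (hmem j hj).1.symm
    (hmem j hj).2.1 (hmem j hj).2.2 ω))).trans ?_
  rw [Finset.sum_add_distrib, ← Finset.sum_div, ← Finset.sum_div, ← Finset.mul_sum,
    Finset.sum_add_distrib, Finset.sum_add_distrib, ← degOn_eq_sum, ← degOn_eq_sum,
    ← Finset.mul_sum, Finset.sum_const, nsmul_eq_mul]
  have hc : ((({i, k, l}ᶜ : Finset V).card : ℝ)) * (8 * p) ≤ 8 * (Fintype.card V * p) := by
    have : ((({i, k, l}ᶜ : Finset V).card : ℝ)) ≤ Fintype.card V := by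
      exact_mod_cast Finset.card_le_univ _
    nlinarith
  gcongr

theorem bernExp_degOn_sq_le {p m : ℝ} (h0 : 0 ≤ p) (h1 : p ≤ 1) (hm : Fintype.card V * p ≤ m)
    (hm1 : 1 ≤ m) (i : V) (s : Finset V) :
    bernExp p (fun ω => (degOn i s ω : ℝ) ^ 2) ≤ 2 * m ^ 2 := by
  have h := bernExp_sum_bit_sq_le h0 h1 (s.image fun x => s(i, x))
  rw [Finset.card_image_of_injective _ (sym2_mk_injective i)] at h
  simp only [degOn, countBits_eq_sum]
  have hs : (s.card : ℝ) * p ≤ m := by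
    refine le_trans (mul_le_mul_of_nonneg_right ?_ h0) hm
    exact_mod_cast Finset.card_le_univ _
  have : (0 : ℝ) ≤ s.card * p := by positivity
  nlinarith

theorem bernExp_diffAt_edgeStepSum_near_le {p μ K m : ℝ} (h0 : 0 ≤ p) (h1 : p ≤ 1) (hμ0 : 0 ≤ μ)
    (hμ1 : μ ≤ p) (hK : 0 < K) (hcard : K ≤ (Fintype.card V - 3) * p)
    (hm : Fintype.card V * p ≤ m) (hm1 : 1 ≤ m) {i k l : V} (hik : i ≠ k)
    (hli : l ≠ i) (hlk : l ≠ k) :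
    bernExp p (fun ω => diffAt s(i, l) (edgeStepSum μ i k) ω ^ 2) ≤ 161280 * m ^ 2 / K ^ 4 := by
  set s : Finset V := {i, k, l}ᶜ with hs
  have hmem : ∀ y ∈ s, y ≠ i ∧ y ≠ k ∧ y ≠ l := by
    intro y hy
    simpa [hs, not_or] using hy
  have hcard' : K ≤ ((s.card : ℝ) + 1) * p := by
    refine hcard.trans (mul_le_mul_of_nonneg_right ?_ h0)
    have := Finset.card_compl_add_card ({i, k, l} : Finset V)
    rw [← hs] at this
    have hc : ({i, k, l} : Finset V).card ≤ 3 := Finset.card_le_three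
    have h3 : Fintype.card V ≤ s.card + 3 := by omega
    have : (Fintype.card V : ℝ) ≤ (s.card : ℝ) + 3 := by exact_mod_cast h3
    linarith
  have hE := bernExp_inv_degOn_pow_le_div h0 h1 hK i hcard' 4
  have hm0 : 0 ≤ Fintype.card V * p := by positivity
  have hpt : ∀ ω, diffAt s(i, l) (edgeStepSum μ i k) ω ^ 2 ≤
      96 * (1 / ((degOn i s ω : ℝ) + 1) ^ 4 * (degOn l s ω : ℝ) ^ 2) +
      96 * (1 / ((degOn i s ω : ℝ) + 1) ^ 4 * (degOn k s ω : ℝ) ^ 2) +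
      3072 * (∑ y ∈ s, bit ω s(i, y) * ((degOn i s ω : ℝ) / ((degOn i s ω : ℝ) + 1) ^ 6) *
        (degOn y (s.erase y) ω : ℝ) ^ 2) +
      192 * m ^ 2 * (1 / ((degOn i s ω : ℝ) + 1) ^ 4) := by
    intro ω
    have habs := abs_diffAt_edgeStepSum_near_le h0 hμ0 hμ1 hik hli hlk ω
    have hsq := sum_commonCount_sq_le i s ω
    rw [← hs] at habs
    rw [← sq_abs]
    have hd : (0 : ℝ) ≤ degOn i s ω := Nat.cast_nonneg _
    have e : ∑ y ∈ s, bit ω s(i, y) * ((degOn i s ω : ℝ) / ((degOn i s ω : ℝ) + 1) ^ 6) *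
        (degOn y (s.erase y) ω : ℝ) ^ 2 = (1 / ((degOn i s ω : ℝ) + 1) ^ 6) *
        ((degOn i s ω : ℝ) * ∑ y ∈ s, bit ω s(i, y) * (degOn y (s.erase y) ω : ℝ) ^ 2) := by
      rw [Finset.mul_sum, Finset.mul_sum]
      exact Finset.sum_congr rfl fun y _ => by ring
    rw [e]
    set Q : ℝ := (degOn i s ω : ℝ) * ∑ y ∈ s, bit ω s(i, y) * (degOn y (s.erase y) ω : ℝ) ^ 2
    set S : ℝ := ∑ j ∈ s, (commonCount i j (s.erase j) ω : ℝ)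
    set d : ℝ := (degOn i s ω : ℝ)
    set a : ℝ := (degOn l s ω : ℝ)
    set b : ℝ := (degOn k s ω : ℝ)
    have hS : 0 ≤ S := Finset.sum_nonneg fun _ _ => Nat.cast_nonneg _
    have hle : |diffAt s(i, l) (edgeStepSum μ i k) ω| ≤
        4 * (a + b) / (d + 1) ^ 2 + (32 * S + 8 * m) / (d + 1) ^ 3 := by
      refine habs.trans ?_
      gcongr
    have h3 : ∀ x y z : ℝ, (x + (y + z)) ^ 2 ≤ 3 * x ^ 2 + 3 * y ^ 2 + 3 * z ^ 2 := fun x y z => by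
      nlinarith [sq_nonneg (x - y), sq_nonneg (x - z), sq_nonneg (y - z)]
    have hmono : 1 / (d + 1) ^ 6 ≤ 1 / (d + 1) ^ 4 :=
      one_div_le_one_div_of_le (by positivity) (pow_le_pow_right₀ (by linarith) (by norm_num))
    calc |diffAt s(i, l) (edgeStepSum μ i k) ω| ^ 2
        ≤ (4 * (a + b) / (d + 1) ^ 2 + (32 * S + 8 * m) / (d + 1) ^ 3) ^ 2 := by gcongr
      _ = (4 * (a + b) / (d + 1) ^ 2 + (32 * S / (d + 1) ^ 3 + 8 * m / (d + 1) ^ 3)) ^ 2 := by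
          rw [add_div]
      _ ≤ 3 * (4 * (a + b) / (d + 1) ^ 2) ^ 2 + 3 * (32 * S / (d + 1) ^ 3) ^ 2 +
          3 * (8 * m / (d + 1) ^ 3) ^ 2 := h3 _ _ _
      _ = 48 * (1 / (d + 1) ^ 4 * (a + b) ^ 2) + 3072 * (1 / (d + 1) ^ 6 * S ^ 2) +
          192 * m ^ 2 * (1 / (d + 1) ^ 6) := by
          field_simp
          ring
      _ ≤ 48 * (1 / (d + 1) ^ 4 * (2 * a ^ 2 + 2 * b ^ 2)) + 3072 * (1 / (d + 1) ^ 6 * Q) +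
          192 * m ^ 2 * (1 / (d + 1) ^ 4) := by
          gcongr
          nlinarith [sq_nonneg (a - b)]
      _ = _ := by ring
  refine (bernExp_mono h0 h1 hpt).trans ?_
  have hdeg : ∀ j, j ≠ i → j ∉ s →
      bernExp p (fun ω => 1 / ((degOn i s ω : ℝ) + 1) ^ 4 * (degOn j s ω : ℝ) ^ 2) ≤
      24 / K ^ 4 * (2 * m ^ 2) := by
    intro j hji hjs
    rw [bernExp_mul_degOn p (t := ((s.image fun x => s(j, x) : Finset (Sym2 V)) : Set (Sym2 V))) ?_
      (dependsOn_comp_degOn i s fun d => 1 / ((d : ℝ) + 1) ^ 4)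
      (dependsOn_comp_degOn j s fun d => (d : ℝ) ^ 2)]
    · refine mul_le_mul ?_ (bernExp_degOn_sq_le h0 h1 hm hm1 j s)
        (bernExp_nonneg h0 h1 fun _ => by positivity) (by positivity)
      simpa [Nat.factorial] using hE
    · intro x hx hmemx
      simp only [Finset.coe_image, Set.mem_image, Finset.mem_coe] at hmemx
      obtain ⟨y, hy, hxy⟩ := hmemx
      exact mk_ne_mk (by grind) hxy
  have hsum : bernExp p (fun ω => ∑ y ∈ s, bit ω s(i, y) *
      ((degOn i s ω : ℝ) / ((degOn i s ω : ℝ) + 1) ^ 6) * (degOn y (s.erase y) ω : ℝ) ^ 2) ≤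
      24 / K ^ 4 * (2 * m ^ 2) := by
    rw [bernExp_sum]
    calc ∑ y ∈ s, bernExp p (fun ω => bit ω s(i, y) *
        ((degOn i s ω : ℝ) / ((degOn i s ω : ℝ) + 1) ^ 6) * (degOn y (s.erase y) ω : ℝ) ^ 2)
        ≤ ∑ y ∈ s, bernExp p (fun ω => bit ω s(i, y) *
        ((degOn i s ω : ℝ) / ((degOn i s ω : ℝ) + 1) ^ 6)) * (2 * m ^ 2) := by
          refine Finset.sum_le_sum fun y hy => ?_
          rw [bernExp_mul_degOn p
            (t := (((s.erase y).image fun x => s(y, x) : Finset (Sym2 V)) : Set (Sym2 V))) ?_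
            (dependsOn_bit_mul_degOn i hy fun d => (d : ℝ) / ((d : ℝ) + 1) ^ 6)
            (dependsOn_comp_degOn y (s.erase y) fun d => (d : ℝ) ^ 2)]
          · refine mul_le_mul_of_nonneg_left (bernExp_degOn_sq_le h0 h1 hm hm1 y _) ?_
            exact bernExp_nonneg h0 h1 fun ω => mul_nonneg (bit_nonneg _ _) (by positivity)
          · intro x hx hmemx
            simp only [Finset.coe_image, Set.mem_image, Finset.mem_coe, Finset.mem_erase] at hmemx
            obtain ⟨z, hz, hxz⟩ := hmemx
            have := hmem y hy
            have := hmem z hz.2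
            exact mk_ne_mk (by grind) hxz
      -- Summing the bits iy restores the degree d, and d²/(d+1)⁶ ≤ 1/(d+1)⁴.
      _ = bernExp p (fun ω => (degOn i s ω : ℝ) * ((degOn i s ω : ℝ) /
            ((degOn i s ω : ℝ) + 1) ^ 6)) * (2 * m ^ 2) := by
          rw [← Finset.sum_mul, ← bernExp_sum]
          simp only [← Finset.sum_mul, ← degOn_eq_sum]
      _ ≤ 24 / K ^ 4 * (2 * m ^ 2) := by
          refine mul_le_mul_of_nonneg_right ?_ (by positivity)
          refine le_trans (bernExp_mono h0 h1 fun ω => ?_) (show bernExp p (fun ω => 1 /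
            ((degOn i s ω : ℝ) + 1) ^ 4) ≤ 24 / K ^ 4 by simpa [Nat.factorial] using hE)
          have hd : (0 : ℝ) ≤ degOn i s ω := Nat.cast_nonneg _
          rw [← mul_div_assoc, div_le_div_iff₀ (by positivity) (by positivity), one_mul,
            pow_add _ 4 2, mul_comm]
          gcongr
          nlinarith
  have hE' : bernExp p (fun ω => 1 / ((degOn i s ω : ℝ) + 1) ^ 4) ≤ 24 / K ^ 4 := by
    simpa [Nat.factorial] using hE
  rw [bernExp_add, bernExp_add, bernExp_add, bernExp_const_mul, bernExp_const_mul,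
    bernExp_const_mul, bernExp_const_mul]
  have h4 := mul_le_mul_of_nonneg_left hE' (show 0 ≤ 192 * m ^ 2 by positivity)
  have hl := hdeg l hli (by simp [hs])
  have hk := hdeg k hik.symm (by simp [hs])
  -- 3360 = 96 + 96 + 3072 + 96, where the last 96 comes from 192 m² = 96 · 2m².
  have : 161280 * m ^ 2 / K ^ 4 = 3360 * (24 / K ^ 4 * (2 * m ^ 2)) := by ring
  rw [this]
  linarith

end VarianceBound

/-! ### Approximation of the total Jaccard index by the edge count. -/

section LinearApproximation

set_option linter.unusedSectionVars false

variable {V : Type*} [Fintype V] [DecidableEq V]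

/-- Each unordered pair occurs among the ordered ones; the overcount only affects constants. -/
theorem sum_sym2_le_sum_sum {h : Sym2 V → ℝ} (hh : ∀ e, 0 ≤ h e) :
    ∑ e, h e ≤ ∑ u, ∑ v, h s(u, v) := by
  rw [← Fintype.sum_prod_type' fun u v => h s(u, v)]
  have hinj : Injective fun e : Sym2 V => Quot.out e := fun e e' hee => by
    rw [← Quot.out_eq e, ← Quot.out_eq e']
    exact congrArg _ hee
  calc ∑ e, h e = ∑ e : Sym2 V, h s((Quot.out e).1, (Quot.out e).2) :=
        Finset.sum_congr rfl fun e _ => congrArg h (Quot.out_eq e).symm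
    _ = ∑ x ∈ Finset.univ.image fun e : Sym2 V => Quot.out e, h s(x.1, x.2) :=
        (Finset.sum_image (f := fun x : V × V => h s(x.1, x.2)) hinj.injOn).symm
    _ ≤ ∑ x : V × V, h s(x.1, x.2) :=
        Finset.sum_le_sum_of_subset_of_nonneg (Finset.subset_univ _) fun x _ _ => hh _

theorem diffAt_edgeStepSum_eq_zero (μ : ℝ) {i k : V} {e : Sym2 V}
    (he : e.IsDiag ∨ e = s(i, k)) (ω : Sym2 V → Bool) :
    diffAt e (edgeStepSum μ i k) ω = 0 := by
  change diffAt e (fun y => ∑ j' ∈ ({i, k}ᶜ : Finset V), edgeStep μ i k j' y) ω = 0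
  rw [diffAt_sum]
  refine Finset.sum_eq_zero fun j hj => ?_
  obtain ⟨hji, hjk⟩ := mem_compl_pair.1 hj
  have hne : ∀ a b, a ≠ b → (a = i → b = k → False) → (a = k → b = i → False) → s(a, b) ≠ e := by
    rintro a b hab h1 h2 rfl
    rcases he with he | he
    · exact hab (Sym2.mk_isDiag_iff.1 he)
    · rcases Sym2.eq_iff.1 he with h | h
      · exact h1 h.1 h.2
      · exact h2 h.1 h.2
  refine diffAt_edgeStep_eq_zero μ ?_ (fun x hxi hxj hxk => ⟨?_, ?_⟩) ω
  · exact hne _ _ hjk (by grind) (by grind)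
  · exact hne _ _ hxi.symm (by grind) (by grind)
  · exact hne _ _ hxj.symm (by grind) (by grind)

/-- Efron–Stein over three kinds of edges: those at `k` (B₁), those at `i` (B₂) and all others (B₃).
As m = np is comparable to K, p(2nB₁ + 2nB₂ + n²B₃) is O(1/K). -/
theorem variance_edgeStepSum_le {p μ K : ℝ} (h0 : 0 ≤ p) (h1 : p ≤ 1) (hμ0 : 0 ≤ μ)
    (hμ1 : μ ≤ p) (hK : 1 ≤ K) (hcard : K = (Fintype.card V - 3) * p)
    (hV : 6 ≤ Fintype.card V) {i k : V} (hik : i ≠ k) :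
    bernExp p (fun ω => edgeStepSum μ i k ω ^ 2) - bernExp p (edgeStepSum μ i k) ^ 2 ≤
      3000000 / K := by
  have hK0 : 0 < K := by linarith
  have hV' : (6 : ℝ) ≤ Fintype.card V := by exact_mod_cast hV
  obtain ⟨m, hm⟩ : ∃ m, m = Fintype.card V * p := ⟨_, rfl⟩
  -- Here n ≥ 6 enters, through n ≤ 2(n-3).
  have hm2 : m ≤ 2 * K := by rw [hm, hcard]; nlinarith
  have hm1 : 1 ≤ m := by
    refine hK.trans ?_
    rw [hm, hcard]
    nlinarith
  set n : ℝ := (Fintype.card V : ℝ)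
  set B₁ : ℝ := 8 / K ^ 2 with hB₁
  set B₂ : ℝ := 161280 * m ^ 2 / K ^ 4 with hB₂
  set B₃ : ℝ := 7296 * p / K ^ 4 with hB₃
  have hB₁0 : 0 ≤ B₁ := by positivity
  have hB₂0 : 0 ≤ B₂ := by positivity
  have hB₃0 : 0 ≤ B₃ := by positivity
  have hfar : ∀ j, j ≠ i → j ≠ k →
      bernExp p (fun ω => diffAt s(j, k) (edgeStepSum μ i k) ω ^ 2) ≤ B₁ := fun j hji hjk =>
    bernExp_diffAt_edgeStepSum_far_le h0 h1 hμ0 (hμ1.trans h1) hK0 hcard.le hik hji hjk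
  have hnear : ∀ l, l ≠ i → l ≠ k →
      bernExp p (fun ω => diffAt s(i, l) (edgeStepSum μ i k) ω ^ 2) ≤ B₂ := fun l hli hlk =>
    bernExp_diffAt_edgeStepSum_near_le h0 h1 hμ0 hμ1 hK0 hcard.le hm.ge hm1 hik hli hlk
  have hbound : ∀ u v, bernExp p (fun ω => diffAt s(u, v) (edgeStepSum μ i k) ω ^ 2) ≤
      (((if u = k then B₁ else 0) + if v = k then B₁ else 0) +
        ((if u = i then B₂ else 0) + if v = i then B₂ else 0)) + B₃ := by
    intro u v
    have hn1 : ∀ w : V, 0 ≤ if w = k then B₁ else 0 := fun w => by split_ifs <;> simp [hB₁0]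
    have hn2 : ∀ w : V, 0 ≤ if w = i then B₂ else 0 := fun w => by split_ifs <;> simp [hB₂0]
    have hzero : (s(u, v).IsDiag ∨ s(u, v) = s(i, k)) →
        bernExp p (fun ω => diffAt s(u, v) (edgeStepSum μ i k) ω ^ 2) = 0 := by
      intro h
      simp only [diffAt_edgeStepSum_eq_zero μ h]
      simp [bernExp_const]
    have := hn1 u
    have := hn1 v
    have := hn2 u
    have := hn2 v
    by_cases huv : u = v
    · rw [hzero (Or.inl (Sym2.mk_isDiag_iff.2 huv))]
      positivity
    by_cases huk : u = k
    · subst huk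
      by_cases hvi : v = i
      · rw [hzero (Or.inr (by rw [hvi, Sym2.eq_swap]))]
        positivity
      · have h := hfar v hvi (Ne.symm huv)
        rw [Sym2.eq_swap] at h
        rw [if_pos rfl] at *
        linarith
    by_cases hui : u = i
    · subst hui
      by_cases hvk : v = k
      · rw [hzero (Or.inr (by rw [hvk]))]
        positivity
      · have h := hnear v (Ne.symm huv) hvk
        rw [if_pos (rfl : u = u)] at *
        linarith
    by_cases hvk : v = k
    · subst hvk
      have h := hfar u hui huk
      rw [if_pos (rfl : v = v)] at *
      linarith
    by_cases hvi : v = i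
    · subst hvi
      have h := hnear u hui huk
      rw [Sym2.eq_swap] at h
      rw [if_pos (rfl : v = v)] at *
      linarith
    have h := bernExp_diffAt_edgeStepSum_generic_le h0 h1 hμ0 hμ1 hK0 hcard.le hik hui huk hvi hvk
      huv
    linarith
  have hsum : ∑ e, bernExp p (fun ω => diffAt e (edgeStepSum μ i k) ω ^ 2) ≤
      2 * n * B₁ + 2 * n * B₂ + n ^ 2 * B₃ := by
    refine (sum_sym2_le_sum_sum fun e => bernExp_nonneg h0 h1 fun ω => sq_nonneg _).trans ?_
    refine (Finset.sum_le_sum fun u _ => Finset.sum_le_sum fun v _ => hbound u v).trans_eq ?_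
    simp only [Finset.sum_add_distrib, Finset.sum_ite_eq', Finset.mem_univ, if_true,
      Finset.sum_const, Finset.card_univ, nsmul_eq_mul]
    simp only [← Finset.mul_sum, Finset.sum_ite_eq', Finset.mem_univ, if_true]
    ring
  refine (efronStein h0 h1 _).trans ?_
  have hS0 : 0 ≤ ∑ e, bernExp p (fun ω => diffAt e (edgeStepSum μ i k) ω ^ 2) :=
    Finset.sum_nonneg fun e _ => bernExp_nonneg h0 h1 fun ω => sq_nonneg _
  calc p * (1 - p) * ∑ e, bernExp p (fun ω => diffAt e (edgeStepSum μ i k) ω ^ 2)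
      ≤ p * ∑ e, bernExp p (fun ω => diffAt e (edgeStepSum μ i k) ω ^ 2) := by
        refine mul_le_mul_of_nonneg_right ?_ hS0
        nlinarith
    _ ≤ p * (2 * n * B₁ + 2 * n * B₂ + n ^ 2 * B₃) := mul_le_mul_of_nonneg_left hsum h0
    _ = 16 * m / K ^ 2 + 322560 * m ^ 3 / K ^ 4 + 7296 * m ^ 2 / K ^ 4 := by
        rw [hB₁, hB₂, hB₃, hm]
        ring
    _ ≤ 16 * (2 * K) / K ^ 2 + 322560 * (2 * K) ^ 3 / K ^ 4 + 7296 * (2 * K) ^ 2 / K ^ 4 := by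
        gcongr
    _ = 32 / K + 2580480 / K + 29184 / K ^ 2 := by
        field_simp
        ring
    _ ≤ 32 / K + 2580480 / K + 29184 / K := by
        gcongr
        nlinarith
    _ ≤ 3000000 / K := by
        rw [← add_div, ← add_div]
        gcongr
        norm_num

/-- The sum of the Jaccard indices over all ordered pairs of distinct vertices. -/
def totalJaccard (μ : ℝ) (ω : Sym2 V → Bool) : ℝ :=
  ∑ a, ∑ b, if a = b then 0 else bitJaccard μ a b ω

theorem bernExp_totalJaccard {p μ : ℝ} (hμ : μ * (2 - p) = p) :
    bernExp p (totalJaccard (V := V) μ) = Fintype.card V * (Fintype.card V - 1) * μ := by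
  have h : ∀ a b : V, bernExp p (fun ω => if a = b then 0 else bitJaccard μ a b ω) =
      if a = b then 0 else μ := by
    intro a b
    split_ifs with hab
    · exact bernExp_const p 0
    · exact bernExp_bitJaccard hμ hab
  change bernExp p (fun ω => ∑ a : V, ∑ b, if a = b then 0 else bitJaccard μ a b ω) = _
  rw [bernExp_sum]
  simp only [bernExp_sum, h]
  have : ∀ a : V, ∑ b, (if a = b then 0 else μ) = (Fintype.card V - 1) * μ := by
    intro a
    have e : ∀ b, (if a = b then 0 else μ) = μ - if a = b then μ else 0 := fun b => by
      split_ifs <;> simp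
    simp only [e, Finset.sum_sub_distrib, Finset.sum_ite_eq, Finset.mem_univ, if_true,
      Finset.sum_const, Finset.card_univ, nsmul_eq_mul]
    ring
  simp only [this, Finset.sum_const, Finset.card_univ, nsmul_eq_mul]
  ring

/-- Only pairs containing exactly one of `i` and `k` feel the edge ik, since a pair's index ignores
its own edge. The factor 2 comes from ordered pairs. -/
theorem diffAt_totalJaccard (μ : ℝ) {i k : V} (hik : i ≠ k) (ω : Sym2 V → Bool) :
    diffAt s(i, k) (totalJaccard μ) ω = 2 * (edgeStepSum μ i k ω + edgeStepSum μ k i ω) := by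
  set D : V → V → ℝ := fun a b =>
    diffAt s(i, k) (fun x => if a = b then 0 else bitJaccard μ a b x) ω with hD
  have hexp : diffAt s(i, k) (totalJaccard μ) ω = ∑ a, ∑ b, D a b := by
    change diffAt s(i, k) (fun x => ∑ a, ∑ b, if a = b then 0 else bitJaccard μ a b x) ω = _
    simp only [diffAt_sum, hD]
  have hself : ∀ a, D a a = 0 := fun a => by simp [hD, diffAt]
  have hne : ∀ a b, a ≠ b → D a b = diffAt s(i, k) (bitJaccard μ a b) ω := fun a b h => by
    simp only [hD, if_neg h]
  have hsymm : ∀ a b, D a b = D b a := by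
    intro a b
    by_cases h : a = b
    · rw [h]
    · rw [hne a b h, hne b a (Ne.symm h), show bitJaccard μ a b = bitJaccard μ b a from
        funext fun x => bitJaccard_comm μ a b x]
  have hz : ∀ a b, (∀ x, x ≠ a → x ≠ b → s(a, x) ≠ s(i, k) ∧ s(b, x) ≠ s(i, k)) → D a b = 0 := by
    intro a b h
    by_cases hab : a = b
    · rw [hab, hself]
    · rw [hne a b hab, diffAt_bitJaccard_eq_zero μ h]
  have hik0 : D i k = 0 := hz i k fun x _ _ => ⟨mk_ne_mk (by grind), mk_ne_mk (by grind)⟩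
  have hfar : ∀ a b, a ≠ i → a ≠ k → b ≠ i → b ≠ k → D a b = 0 := fun a b _ _ _ _ =>
    hz a b fun x _ _ => ⟨mk_ne_mk (by grind), mk_ne_mk (by grind)⟩
  have hi : ∀ b ∈ ({i, k}ᶜ : Finset V), D i b = edgeStep μ i k b ω := by
    intro b hb
    obtain ⟨h1, h2⟩ := mem_compl_pair.1 hb
    rw [hne i b h1.symm, diffAt_bitJaccard μ h1.symm hik h2]
  have hk : ∀ b ∈ ({i, k}ᶜ : Finset V), D k b = edgeStep μ k i b ω := by
    intro b hb
    obtain ⟨h1, h2⟩ := mem_compl_pair.1 hb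
    rw [hne k b h2.symm, Sym2.eq_swap, diffAt_bitJaccard μ h2.symm hik.symm h1]
  have hsplit : ∀ f : V → ℝ, ∑ a, f a = f i + f k + ∑ a ∈ ({i, k}ᶜ : Finset V), f a := fun f => by
    rw [← Finset.sum_pair hik, Finset.sum_add_sum_compl]
  have hrowi : ∑ b, D i b = edgeStepSum μ i k ω := by
    rw [hsplit, hself, hik0, Finset.sum_congr rfl hi, edgeStepSum, add_zero, zero_add]
  have hrowk : ∑ b, D k b = edgeStepSum μ k i ω := by
    rw [hsplit, hself, hsymm k i, hik0, Finset.sum_congr rfl hk, edgeStepSum,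
      Finset.pair_comm k i, add_zero, zero_add]
  have hrest : ∀ a ∈ ({i, k}ᶜ : Finset V), ∑ b, D a b = D i a + D k a := by
    intro a ha
    obtain ⟨h1, h2⟩ := mem_compl_pair.1 ha
    rw [hsplit, Finset.sum_eq_zero fun b hb => hfar a b h1 h2 (mem_compl_pair.1 hb).1
      (mem_compl_pair.1 hb).2, add_zero, hsymm a i, hsymm a k]
  rw [hexp, hsplit, hrowi, hrowk, Finset.sum_congr rfl hrest, Finset.sum_add_distrib,
    Finset.sum_congr rfl hi, Finset.sum_congr rfl hk]
  rw [edgeStepSum, edgeStepSum, Finset.pair_comm k i]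
  ring

theorem diffAt_totalJaccard_of_isDiag (μ : ℝ) {e : Sym2 V} (he : e.IsDiag) (ω : Sym2 V → Bool) :
    diffAt e (totalJaccard μ) ω = 0 := by
  change diffAt e (fun x => ∑ a, ∑ b, if a = b then 0 else bitJaccard μ a b x) ω = 0
  rw [diffAt_sum]
  refine Finset.sum_eq_zero fun a _ => ?_
  rw [diffAt_sum]
  refine Finset.sum_eq_zero fun b _ => ?_
  by_cases hab : a = b
  · simp [hab, diffAt]
  · simp only [if_neg hab]
    refine diffAt_bitJaccard_eq_zero μ (fun x hxa hxb => ⟨?_, ?_⟩) ω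
    · rintro rfl
      exact hxa (Sym2.mk_isDiag_iff.1 he).symm
    · rintro rfl
      exact hxb (Sym2.mk_isDiag_iff.1 he).symm

/-- The derivative in mean of the sum of all Jaccard indices with respect to one edge. -/
def meanStep (n : ℕ) (p : ℝ) : ℝ := 4 * (1 - (1 - p) ^ (2 * (n - 2))) / (2 - p) ^ 2

theorem bernExp_edgeStepSum {p μ : ℝ} (h1 : p ≤ 1) (hμ : μ * (2 - p) = p) {i k : V} (hik : i ≠ k) :
    4 * bernExp p (edgeStepSum μ i k) = meanStep (Fintype.card V) p := by
  have hp : (2 - p) ≠ 0 := by linarith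
  change 4 * bernExp p (fun ω => ∑ j ∈ ({i, k}ᶜ : Finset V), edgeStep μ i k j ω) = _
  rw [bernExp_sum, meanStep, eq_div_iff (pow_ne_zero 2 hp)]
  have hc : (({i, k}ᶜ : Finset V).card : ℝ) = Fintype.card V - 2 := by
    have := Finset.card_compl_add_card ({i, k} : Finset V)
    rw [Finset.card_pair hik] at this
    have : ((({i, k}ᶜ : Finset V).card : ℝ)) + 2 = Fintype.card V := by exact_mod_cast this
    linarith
  -- With only two vertices the sum is empty, and the exponent 2(n-2) = 0 makes the other side
  -- vanish too.
  rcases Finset.eq_empty_or_nonempty ({i, k}ᶜ : Finset V) with he | ⟨j₀, hj₀⟩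
  · rw [he] at hc ⊢
    simp only [Finset.card_empty, Nat.cast_zero] at hc
    have : Fintype.card V = 2 := by
      have : (Fintype.card V : ℝ) = 2 := by linarith
      exact_mod_cast this
    simp [this]
  · have key : ∀ j ∈ ({i, k}ᶜ : Finset V), (Fintype.card V - 2) * (2 - p) ^ 2 *
        bernExp p (edgeStep μ i k j) = 1 - (1 - p) ^ (2 * (Fintype.card V - 2)) := fun j hj =>
      bernExp_edgeStep hμ (mem_compl_pair.1 hj).1.symm hik (mem_compl_pair.1 hj).2
    have hpos : (0 : ℝ) < Fintype.card V - 2 := by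
      rw [← hc]
      exact_mod_cast Finset.card_pos.2 ⟨j₀, hj₀⟩
    have hsum := Finset.sum_congr rfl key
    rw [← Finset.mul_sum, Finset.sum_const, nsmul_eq_mul, hc, mul_assoc] at hsum
    have := mul_left_cancel₀ hpos.ne' hsum
    linear_combination 4 * this

/-- The edges of the complete graph. -/
def offDiag (V : Type*) [Fintype V] [DecidableEq V] : Finset (Sym2 V) :=
  Finset.univ.filter fun e => ¬ e.IsDiag

/-- The sum of the Jaccard indices is close to a linear function of the edge indicators. -/
theorem bernExp_totalJaccard_sub_linear_sq_le {p μ K : ℝ} (h0 : 0 ≤ p) (h1 : p ≤ 1) (hμ0 : 0 ≤ μ)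
    (hμ1 : μ ≤ p) (hμ : μ * (2 - p) = p) (hK : 1 ≤ K) (hcard : K = (Fintype.card V - 3) * p)
    (hV : 6 ≤ Fintype.card V) :
    bernExp p (fun ω : Sym2 V → Bool => (totalJaccard μ ω -
      Fintype.card V * (Fintype.card V - 1) * μ -
      meanStep (Fintype.card V) p * ∑ e ∈ offDiag V, (bit ω e - p)) ^ 2) ≤
      p * (1 - p) * Fintype.card V ^ 2 * (48000000 / K) := by
  set c : ℝ := meanStep (Fintype.card V) p
  set f : (Sym2 V → Bool) → ℝ := fun ω => totalJaccard μ ω - c * ∑ e ∈ offDiag V, (bit ω e - p)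
    with hf
  have hK0 : 0 < K := by linarith
  have hmean : bernExp p f = Fintype.card V * (Fintype.card V - 1) * μ := by
    rw [hf, bernExp_sub, bernExp_const_mul, bernExp_sum, bernExp_totalJaccard hμ]
    simp [bernExp_sub, bernExp_bit, bernExp_const]
  have hfc : (fun ω : Sym2 V → Bool => (totalJaccard μ ω -
      Fintype.card V * (Fintype.card V - 1) * μ - c * ∑ e ∈ offDiag V, (bit ω e - p)) ^ 2) =
      fun ω => (f ω - Fintype.card V * (Fintype.card V - 1) * μ) ^ 2 := by
    funext ω
    simp only [hf]
    ring
  rw [hfc, bernExp_sq_sub_const p _ f hmean]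
  refine (efronStein h0 h1 f).trans ?_
  have hlin : ∀ e ω, diffAt e f ω =
      diffAt e (totalJaccard μ) ω - c * if e ∈ offDiag V then 1 else 0 := by
    intro e ω
    have hb : ∀ e' ω', diffAt e (fun x => bit x e' - p) ω' = diffAt e (fun x => bit x e') ω' :=
      fun e' ω' => by simp only [diffAt]; ring
    have hs : diffAt e (fun x => ∑ e' ∈ offDiag V, (bit x e' - p)) ω =
        if e ∈ offDiag V then 1 else 0 := by
      simp only [diffAt_sum, hb, diffAt_bit, Finset.sum_ite_eq]
    rw [← hs]
    simp only [hf, diffAt]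
    ring
  -- Off the diagonal, `c` is the mean of the derivative of the total, so the derivative of `f` is
  -- centred and its second moment is a variance. This is where the second use of Efron–Stein
  -- enters.
  have hB : ∀ u v, bernExp p (fun ω => diffAt s(u, v) f ω ^ 2) ≤ 48000000 / K := by
    intro u v
    by_cases huv : u = v
    · have hd : s(u, v).IsDiag := Sym2.mk_isDiag_iff.2 huv
      have : s(u, v) ∉ offDiag V := by simp [offDiag, huv]
      simp only [hlin, diffAt_totalJaccard_of_isDiag μ hd, if_neg this]
      rw [mul_zero, sub_zero, zero_pow two_ne_zero, bernExp_const]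
      positivity
    · have hmem : s(u, v) ∈ offDiag V := by simp [offDiag, huv]
      have hm1 := bernExp_edgeStepSum h1 hμ huv
      have hm2 := bernExp_edgeStepSum h1 hμ (Ne.symm huv)
      have hv1 := variance_edgeStepSum_le h0 h1 hμ0 hμ1 hK hcard hV huv
      have hv2 := variance_edgeStepSum_le h0 h1 hμ0 hμ1 hK hcard hV (Ne.symm huv)
      rw [← bernExp_sq_sub_const p _ _ rfl] at hv1 hv2
      set E₁ := bernExp p (edgeStepSum μ u v)
      set E₂ := bernExp p (edgeStepSum μ v u)
      calc bernExp p (fun ω => diffAt s(u, v) f ω ^ 2)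
          ≤ bernExp p (fun ω => 8 * (edgeStepSum μ u v ω - E₁) ^ 2 +
              8 * (edgeStepSum μ v u ω - E₂) ^ 2) := by
            refine bernExp_mono h0 h1 fun ω => ?_
            rw [hlin, if_pos hmem, diffAt_totalJaccard μ huv,
              show c = 2 * E₁ + 2 * E₂ by linarith]
            nlinarith [sq_nonneg ((edgeStepSum μ u v ω - E₁) - (edgeStepSum μ v u ω - E₂))]
        _ = 8 * bernExp p (fun ω => (edgeStepSum μ u v ω - E₁) ^ 2) +
              8 * bernExp p (fun ω => (edgeStepSum μ v u ω - E₂) ^ 2) := by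
            rw [bernExp_add, bernExp_const_mul, bernExp_const_mul]
        _ ≤ 8 * (3000000 / K) + 8 * (3000000 / K) := by gcongr
        _ = 48000000 / K := by ring
  have hpp : 0 ≤ p * (1 - p) := mul_nonneg h0 (sub_nonneg.2 h1)
  rw [mul_assoc (p * (1 - p))]
  refine mul_le_mul_of_nonneg_left ?_ hpp
  refine (sum_sym2_le_sum_sum fun e => bernExp_nonneg h0 h1 fun ω => sq_nonneg _).trans ?_
  refine (Finset.sum_le_sum fun u _ => Finset.sum_le_sum fun v _ => hB u v).trans_eq ?_
  simp only [Finset.sum_const, Finset.card_univ, nsmul_eq_mul]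
  ring

end LinearApproximation

/-! ### Characteristic functions of centred Bernoulli sums. -/

section CharacteristicFunction

/-- The characteristic function of a centred Bernoulli variable of parameter `p`. -/
def bernChar (p θ : ℝ) : ℂ :=
  p * Complex.exp (θ * (1 - p) * Complex.I) + (1 - p) * Complex.exp (-(θ * p) * Complex.I)

theorem norm_bernChar_le {p : ℝ} (h0 : 0 ≤ p) (h1 : p ≤ 1) (θ : ℝ) : ‖bernChar p θ‖ ≤ 1 := by
  have e1 : ‖Complex.exp (θ * (1 - p) * Complex.I)‖ = 1 := by
    have := Complex.norm_exp_ofReal_mul_I (θ * (1 - p))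
    simpa using this
  have e2 : ‖Complex.exp (-(θ * p) * Complex.I)‖ = 1 := by
    have := Complex.norm_exp_ofReal_mul_I (-(θ * p))
    simpa using this
  have e3 : ‖(1 - p : ℂ)‖ = 1 - p := by
    rw [← Complex.ofReal_one, ← Complex.ofReal_sub, Complex.norm_real, Real.norm_eq_abs,
      abs_of_nonneg (by linarith)]
  refine (norm_add_le _ _).trans ?_
  rw [norm_mul, norm_mul, e1, e2, e3, Complex.norm_real, Real.norm_eq_abs, abs_of_nonneg h0]
  linarith

theorem norm_exp_mul_I_sub_le {x : ℝ} (hx : |x| ≤ 1) :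
    ‖Complex.exp (x * Complex.I) - (1 + x * Complex.I - x ^ 2 / 2)‖ ≤ |x| ^ 3 := by
  have hn : ‖(x : ℂ) * Complex.I‖ = |x| := by simp
  have h := Complex.exp_bound (x := x * Complex.I) (by rw [hn]; exact hx) (n := 3) (by norm_num)
  have hsum : ∑ m ∈ Finset.range 3, ((x : ℂ) * Complex.I) ^ m / (m.factorial : ℂ) =
      1 + x * Complex.I - x ^ 2 / 2 := by
    simp [Finset.sum_range_succ, mul_pow, Complex.I_sq]
    ring
  rw [hsum, hn] at h
  refine h.trans ?_
  have : (0 : ℝ) ≤ |x| ^ 3 := by positivity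
  norm_num [Nat.factorial]
  linarith

/-- The linear Taylor terms cancel and the quadratic ones combine to p(1-p)θ²/2. Keeping the factor
p(1-p) in the error is essential, because p may approach 0 or 1. -/
theorem norm_bernChar_sub_le {p : ℝ} (h0 : 0 ≤ p) (h1 : p ≤ 1) {θ : ℝ} (hθ : |θ| ≤ 1) :
    ‖bernChar p θ - (1 - ((p * (1 - p) * θ ^ 2 / 2 : ℝ) : ℂ))‖ ≤ p * (1 - p) * |θ| ^ 3 := by
  have hq : 0 ≤ 1 - p := by linarith
  have ha : |θ * (1 - p)| = |θ| * (1 - p) := by rw [abs_mul, abs_of_nonneg hq]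
  have hb : |-(θ * p)| = |θ| * p := by rw [abs_neg, abs_mul, abs_of_nonneg h0]
  have hθ0 := abs_nonneg θ
  have h2 := norm_exp_mul_I_sub_le (x := θ * (1 - p)) (by rw [ha]; nlinarith)
  have h3 := norm_exp_mul_I_sub_le (x := -(θ * p)) (by rw [hb]; nlinarith)
  have e : bernChar p θ - (1 - ((p * (1 - p) * θ ^ 2 / 2 : ℝ) : ℂ)) =
      (p : ℂ) * (Complex.exp ((θ * (1 - p) : ℝ) * Complex.I) -
        (1 + (θ * (1 - p) : ℝ) * Complex.I - ((θ * (1 - p) : ℝ) : ℂ) ^ 2 / 2)) +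
      ((1 - p : ℝ) : ℂ) * (Complex.exp ((-(θ * p) : ℝ) * Complex.I) -
        (1 + (-(θ * p) : ℝ) * Complex.I - ((-(θ * p) : ℝ) : ℂ) ^ 2 / 2)) := by
    simp only [bernChar]
    push_cast
    ring
  rw [e]
  refine (norm_add_le _ _).trans ?_
  rw [norm_mul, norm_mul, Complex.norm_real, Complex.norm_real, Real.norm_eq_abs, Real.norm_eq_abs,
    abs_of_nonneg h0, abs_of_nonneg hq]
  have h4 := mul_le_mul_of_nonneg_left h2 h0
  have h5 := mul_le_mul_of_nonneg_left h3 hq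
  rw [ha] at h4
  rw [hb] at h5
  have hθ3 : 0 ≤ |θ| ^ 3 := by positivity
  have h6 : p * (|θ| * (1 - p)) ^ 3 + (1 - p) * (|θ| * p) ^ 3 ≤ p * (1 - p) * |θ| ^ 3 := by
    have : (1 - p) ^ 2 + p ^ 2 ≤ 1 := by nlinarith
    have := mul_le_mul_of_nonneg_left this (mul_nonneg (mul_nonneg h0 hq) hθ3)
    nlinarith
  linarith

theorem norm_pow_sub_pow_le {z w : ℂ} (hz : ‖z‖ ≤ 1) (hw : ‖w‖ ≤ 1) (N : ℕ) :
    ‖z ^ N - w ^ N‖ ≤ N * ‖z - w‖ := by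
  induction N with
  | zero => simp
  | succ N ih =>
    have e : z ^ (N + 1) - w ^ (N + 1) = z ^ N * (z - w) + (z ^ N - w ^ N) * w := by ring
    rw [e]
    refine (norm_add_le _ _).trans ?_
    rw [norm_mul, norm_mul, norm_pow]
    have h1 : ‖z‖ ^ N ≤ 1 := pow_le_one₀ (norm_nonneg _) hz
    have h2 := mul_le_mul_of_nonneg_right h1 (norm_nonneg (z - w))
    have h3 := mul_le_mul ih hw (norm_nonneg _) (by positivity)
    push_cast
    linarith

/-- A quantitative central limit theorem for sums of independent Bernoulli variables. -/
theorem norm_bernChar_pow_sub_le {p : ℝ} (h0 : 0 ≤ p) (h1 : p ≤ 1) {θ : ℝ} (hθ : |θ| ≤ 1) (N : ℕ) :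
    ‖bernChar p θ ^ N - ((Real.exp (-(N * (p * (1 - p) * θ ^ 2) / 2)) : ℝ) : ℂ)‖ ≤
      N * (p * (1 - p) * θ ^ 2) * (2 * |θ|) := by
  have hpp : 0 ≤ p * (1 - p) := mul_nonneg h0 (by linarith)
  have hpp1 : p * (1 - p) ≤ 1 := by nlinarith
  have hθ0 := abs_nonneg θ
  have hθ2 : θ ^ 2 ≤ |θ| := by rw [← sq_abs]; nlinarith
  obtain ⟨y, hy⟩ : ∃ y, y = p * (1 - p) * θ ^ 2 / 2 := ⟨_, rfl⟩
  have hy0 : 0 ≤ y := by rw [hy]; positivity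
  have hy2 : 2 * y ≤ |θ| := by
    rw [hy]
    nlinarith [sq_nonneg θ]
  have hw : ‖((Real.exp (-y) : ℝ) : ℂ)‖ ≤ 1 := by
    rw [Complex.norm_real, Real.norm_eq_abs, abs_of_pos (Real.exp_pos _)]
    exact Real.exp_le_one_iff.2 (by linarith)
  have hexp : Real.exp (-(N * (p * (1 - p) * θ ^ 2) / 2)) = Real.exp (-y) ^ N := by
    rw [← Real.exp_nat_mul, hy]
    congr 1
    ring
  rw [hexp, Complex.ofReal_pow]
  refine (norm_pow_sub_pow_le (norm_bernChar_le h0 h1 θ) hw N).trans ?_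
  rw [mul_assoc]
  refine mul_le_mul_of_nonneg_left ?_ (Nat.cast_nonneg N)
  have hA := norm_bernChar_sub_le h0 h1 hθ
  rw [← hy] at hA
  have hB : ‖((Real.exp (-y) : ℝ) : ℂ) - (1 - (y : ℂ))‖ ≤ y ^ 2 := by
    have := Real.abs_exp_sub_one_sub_id_le (x := -y) (by rw [abs_neg, abs_of_nonneg hy0]; linarith)
    rw [← Complex.ofReal_one, ← Complex.ofReal_sub, ← Complex.ofReal_sub, Complex.norm_real,
      Real.norm_eq_abs]
    rw [neg_sq] at this
    convert this using 2
    ring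
  have htri : ‖bernChar p θ - ((Real.exp (-y) : ℝ) : ℂ)‖ ≤
      ‖bernChar p θ - (1 - (y : ℂ))‖ + ‖((Real.exp (-y) : ℝ) : ℂ) - (1 - (y : ℂ))‖ := by
    have := norm_sub_le (bernChar p θ - (1 - (y : ℂ))) (((Real.exp (-y) : ℝ) : ℂ) - (1 - (y : ℂ)))
    simpa using this
  have h3 : p * (1 - p) * |θ| ^ 3 = 2 * y * |θ| := by
    rw [hy, pow_succ, sq_abs]
    ring
  rw [h3] at hA
  -- Each factor has error at most 2y|θ| + y², and y ≤ |θ|/2.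
  have : p * (1 - p) * θ ^ 2 = 2 * y := by rw [hy]; ring
  rw [this]
  nlinarith

theorem tendsto_bernChar_pow {p θ : ℕ → ℝ} {N : ℕ → ℕ} {v : ℝ} (h0 : ∀ n, 0 ≤ p n)
    (h1 : ∀ n, p n ≤ 1) (hθ : Tendsto θ atTop (𝓝 0))
    (hv : Tendsto (fun n => (N n : ℝ) * (p n * (1 - p n) * θ n ^ 2)) atTop (𝓝 v)) :
    Tendsto (fun n => bernChar (p n) (θ n) ^ N n) atTop (𝓝 ((Real.exp (-(v / 2)) : ℝ) : ℂ)) := by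
  have habs : Tendsto (fun n => |θ n|) atTop (𝓝 0) := by simpa using hθ.abs
  have hexp : Tendsto (fun n => ((Real.exp (-(N n * (p n * (1 - p n) * θ n ^ 2) / 2)) : ℝ) : ℂ))
      atTop (𝓝 ((Real.exp (-(v / 2)) : ℝ) : ℂ)) :=
    (Complex.continuous_ofReal.tendsto _).comp
      ((Real.continuous_exp.tendsto _).comp (hv.div_const 2).neg)
  have hz : Tendsto (fun n => (N n : ℝ) * (p n * (1 - p n) * θ n ^ 2) * (2 * |θ n|)) atTop
      (𝓝 0) := by
    simpa using hv.mul (habs.const_mul 2)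
  have hdiff : Tendsto (fun n => bernChar (p n) (θ n) ^ N n -
      ((Real.exp (-(N n * (p n * (1 - p n) * θ n ^ 2) / 2)) : ℝ) : ℂ)) atTop (𝓝 0) := by
    refine squeeze_zero_norm' ?_ hz
    filter_upwards [habs.eventually (eventually_le_nhds one_pos)] with n hn
    exact norm_bernChar_pow_sub_le (h0 n) (h1 n) hn (N n)
  simpa using hdiff.add hexp

variable {ι : Type*} [Fintype ι] [DecidableEq ι]

theorem sum_bernWeight_mul_exp (p θ : ℝ) (s : Finset ι) :
    ∑ ω : ι → Bool, (bernWeight p ω : ℂ) *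
      Complex.exp ((θ * ∑ i ∈ s, (bit ω i - p) : ℝ) * Complex.I) = bernChar p θ ^ s.card := by
  have h := Finset.prod_univ_sum (fun _ : ι => (Finset.univ : Finset Bool))
    (fun i b => ((if b then p else 1 - p : ℝ) : ℂ) *
      if i ∈ s then Complex.exp ((θ * ((if b then 1 else 0) - p) : ℝ) * Complex.I) else 1)
  simp only [Fintype.piFinset_univ] at h
  have hL : ∏ i : ι, ∑ b : Bool, (((if b then p else 1 - p : ℝ) : ℂ) *
      if i ∈ s then Complex.exp ((θ * ((if b then 1 else 0) - p) : ℝ) * Complex.I) else 1) =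
      bernChar p θ ^ s.card := by
    have : ∀ i : ι, ∑ b : Bool, (((if b then p else 1 - p : ℝ) : ℂ) *
      if i ∈ s then Complex.exp ((θ * ((if b then 1 else 0) - p) : ℝ) * Complex.I) else 1) =
        if i ∈ s then bernChar p θ else 1 := by
      intro i
      rw [Fintype.sum_bool]
      by_cases hi : i ∈ s <;> simp [hi, bernChar]
    simp only [this, Finset.prod_ite_mem, Finset.univ_inter, Finset.prod_const]
  rw [← hL, h]
  refine Finset.sum_congr rfl fun ω _ => ?_
  rw [Finset.prod_mul_distrib, Finset.prod_ite_mem, Finset.univ_inter, ← Complex.exp_sum, bernWeight]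
  have hexp : ((θ * ∑ i ∈ s, (bit ω i - p) : ℝ) : ℂ) * Complex.I =
      ∑ i ∈ s, ((θ * ((if ω i then 1 else 0) - p) : ℝ) : ℂ) * Complex.I := by
    rw [Finset.mul_sum, Complex.ofReal_sum, Finset.sum_mul]
    rfl
  rw [hexp, Complex.ofReal_prod]

/-- L²-closeness suffices for characteristic functions: x ↦ exp(ix) is 1-Lipschitz, and Jensen
bounds the first absolute moment. -/
theorem norm_sum_bernWeight_exp_sub_le {p : ℝ} (h0 : 0 ≤ p) (h1 : p ≤ 1)
    (X Y : (ι → Bool) → ℝ) (t : ℝ) :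
    ‖∑ ω, (bernWeight p ω : ℂ) * Complex.exp ((t * X ω : ℝ) * Complex.I) -
      ∑ ω, (bernWeight p ω : ℂ) * Complex.exp ((t * Y ω : ℝ) * Complex.I)‖ ≤
      |t| * √(bernExp p fun ω => (X ω - Y ω) ^ 2) := by
  rw [← Finset.sum_sub_distrib]
  have hpt : ∀ a b : ℝ, ‖Complex.exp (a * Complex.I) - Complex.exp (b * Complex.I)‖ ≤ |a - b| := by
    intro a b
    have e : Complex.exp (a * Complex.I) - Complex.exp (b * Complex.I) =
        Complex.exp (b * Complex.I) * (Complex.exp (Complex.I * (a - b : ℝ)) - 1) := by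
      rw [mul_sub, ← Complex.exp_add, mul_one]
      congr 2
      push_cast
      ring
    rw [e, norm_mul, Complex.norm_exp_ofReal_mul_I, one_mul]
    simpa using Real.norm_exp_I_mul_ofReal_sub_one_le (x := a - b)
  calc ‖∑ ω, ((bernWeight p ω : ℂ) * Complex.exp ((t * X ω : ℝ) * Complex.I) -
      (bernWeight p ω : ℂ) * Complex.exp ((t * Y ω : ℝ) * Complex.I))‖
      ≤ ∑ ω, bernWeight p ω * (|t| * |X ω - Y ω|) := by
        refine (norm_sum_le _ _).trans (Finset.sum_le_sum fun ω _ => ?_)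
        rw [← mul_sub, norm_mul, Complex.norm_real, Real.norm_eq_abs,
          abs_of_nonneg (bernWeight_nonneg h0 h1 ω)]
        refine mul_le_mul_of_nonneg_left ((hpt _ _).trans_eq ?_) (bernWeight_nonneg h0 h1 ω)
        rw [← mul_sub, abs_mul]
    _ = |t| * bernExp p fun ω => |X ω - Y ω| := bernExp_const_mul p |t| fun ω => |X ω - Y ω|
    _ ≤ |t| * √(bernExp p fun ω => (X ω - Y ω) ^ 2) := by
        refine mul_le_mul_of_nonneg_left (Real.le_sqrt_of_sq_le ?_) (abs_nonneg t)
        have := bernExp_sq_le_bernExp_sq h0 h1 fun ω => |X ω - Y ω|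
        simpa only [sq_abs] using this

end CharacteristicFunction

/-! ### Transfer from the bit cube to the random graph. -/

section RandomGraph

theorem measurableSingletonClass_simpleGraph (V : Type*) [Countable V] :
    MeasurableSingletonClass (SimpleGraph V) := by
  refine ⟨fun G => ?_⟩
  have h : ({G} : Set (SimpleGraph V)) = SimpleGraph.edgeSet ⁻¹' {G.edgeSet} := by
    ext G'
    simp
  rw [h]
  exact SimpleGraph.measurable_edgeSet (measurableSet_singleton _)

variable {V : Type*}

/-- The graph whose edges are the non-diagonal pairs `e` with `ω e = true`. -/
def graphOf (ω : Sym2 V → Bool) : SimpleGraph V := SimpleGraph.fromEdgeSet {e | ω e = true}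

theorem graphOf_adj (ω : Sym2 V → Bool) (i j : V) :
    (graphOf ω).Adj i j ↔ ω s(i, j) = true ∧ i ≠ j := by
  simp [graphOf]

variable [Fintype V] [DecidableEq V]

theorem mem_offDiag {e : Sym2 V} : e ∈ offDiag V ↔ ¬ e.IsDiag := by simp [offDiag]

theorem card_offDiag : (offDiag V).card = (Fintype.card V).choose 2 := by
  rw [← Sym2.card_subtype_not_diag, Fintype.card_subtype]
  rfl

theorem graphOf_eq_iff (ω : Sym2 V → Bool) (G : SimpleGraph V) :
    graphOf ω = G ↔ ∀ e ∈ offDiag V, (ω e = true ↔ e ∈ G.edgeSet) := by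
  constructor
  · rintro rfl e he
    induction e with
    | _ i j =>
      have hij : i ≠ j := fun h => mem_offDiag.1 he (Sym2.mk_isDiag_iff.2 h)
      rw [SimpleGraph.mem_edgeSet, graphOf_adj]
      simp [hij]
  · intro h
    ext i j
    rw [graphOf_adj]
    constructor
    · rintro ⟨h1, hij⟩
      exact (h s(i, j) (mem_offDiag.2 fun hd => hij (Sym2.mk_isDiag_iff.1 hd))).1 h1
    · intro hadj
      exact ⟨(h s(i, j) (mem_offDiag.2 fun hd => hadj.ne (Sym2.mk_isDiag_iff.1 hd))).2 hadj,
        hadj.ne⟩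

open Classical in
-- Diagonal bits do not affect the graph and their factors sum to one; every other bit is forced by
-- `G`.
theorem sum_bernWeight_graphOf_eq (p : ℝ) (G : SimpleGraph V) :
    ∑ ω : Sym2 V → Bool, bernWeight p ω * (if graphOf ω = G then 1 else 0) =
      p ^ G.edgeSet.ncard * (1 - p) ^ ((Nat.card V).choose 2 - G.edgeSet.ncard) := by
  have h := Finset.prod_univ_sum (fun _ : Sym2 V => (Finset.univ : Finset Bool))
    (fun e b => (if b then p else 1 - p) *
      if e ∈ offDiag V then (if (b = true ↔ e ∈ G.edgeSet) then 1 else 0) else (1 : ℝ))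
  simp only [Fintype.piFinset_univ] at h
  have hω : ∀ ω : Sym2 V → Bool, bernWeight p ω * (if graphOf ω = G then 1 else 0) =
      ∏ e, (if ω e then p else 1 - p) *
        if e ∈ offDiag V then (if (ω e = true ↔ e ∈ G.edgeSet) then 1 else 0) else (1 : ℝ) := by
    intro ω
    rw [Finset.prod_mul_distrib, Finset.prod_ite_mem, Finset.univ_inter, Finset.prod_boole,
      bernWeight]
    simp only [graphOf_eq_iff]
    congr
  rw [Finset.sum_congr rfl fun ω _ => hω ω, ← h]
  have hfac : ∀ e : Sym2 V, ∑ b : Bool, ((if b then p else 1 - p) *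
      if e ∈ offDiag V then (if (b = true ↔ e ∈ G.edgeSet) then 1 else 0) else (1 : ℝ)) =
      if e ∈ offDiag V then (if e ∈ G.edgeSet then p else 1 - p) else 1 := by
    intro e
    rw [Fintype.sum_bool]
    by_cases he : e ∈ offDiag V <;> by_cases hG : e ∈ G.edgeSet <;> simp [he, hG]
  simp only [hfac, Finset.prod_ite_mem, Finset.univ_inter]
  rw [Finset.prod_ite, Finset.prod_const, Finset.prod_const]
  have hc1 : ((offDiag V).filter fun e => e ∈ G.edgeSet).card = G.edgeSet.ncard := by
    rw [← Set.ncard_coe_finset]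
    congr 1
    ext e
    simp only [Finset.coe_filter, mem_offDiag, Set.mem_ofPred_eq, and_iff_right_iff_imp]
    exact fun he => G.not_isDiag_of_mem_edgeSet he
  have hc2 := Finset.card_filter_add_card_filter_not (s := offDiag V) (fun e => e ∈ G.edgeSet)
  rw [hc1, card_offDiag, ← Nat.card_eq_fintype_card] at hc2
  rw [hc1, show ((offDiag V).filter fun e => ¬ e ∈ G.edgeSet).card =
    (Nat.card V).choose 2 - G.edgeSet.ncard by omega]

theorem integral_binomialRandom (p : I) (f : SimpleGraph V → ℂ) :
    ∫ G, f G ∂(SimpleGraph.binomialRandom V p) =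
      ∑ ω : Sym2 V → Bool, (bernWeight (p : ℝ) ω : ℂ) * f (graphOf ω) := by
  classical
  have := measurableSingletonClass_simpleGraph V
  have := Fintype.ofFinite (SimpleGraph V)
  rw [integral_fintype (Integrable.of_finite)]
  have hG : ∀ G : SimpleGraph V, (SimpleGraph.binomialRandom V p).real {G} =
      ∑ ω : Sym2 V → Bool, bernWeight (p : ℝ) ω * (if graphOf ω = G then 1 else 0) := by
    intro G
    rw [sum_bernWeight_graphOf_eq, measureReal_def, SimpleGraph.binomialRandom_singleton]
    simp [ENNReal.toReal_mul]
  simp only [hG, Complex.real_smul, Complex.ofReal_sum, Finset.sum_mul]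
  rw [Finset.sum_comm]
  refine Finset.sum_congr rfl fun ω _ => ?_
  rw [Finset.sum_eq_single (graphOf ω)]
  · simp
  · intro G _ hG
    simp [Ne.symm hG]
  · simp

theorem jaccardIndex_graphOf (p : ℝ) (i j : V) (ω : Sym2 V → Bool) :
    jaccardIndex p (graphOf ω) i j = bitJaccard (p / (2 - p)) i j ω := by
  have h1 : unionNeighbors (graphOf ω) i j = (({i, j}ᶜ : Finset V).filter fun x =>
      ω s(i, x) = true ∨ ω s(j, x) = true : Finset V) := by
    ext x
    simp only [unionNeighbors, Set.mem_ofPred_eq, graphOf_adj, Finset.coe_filter,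
      mem_compl_pair]
    constructor
    · rintro ⟨hi, hj, h⟩
      exact ⟨⟨hi, hj⟩, h.imp And.left And.left⟩
    · rintro ⟨⟨hi, hj⟩, h⟩
      exact ⟨hi, hj, h.imp (fun h => ⟨h, hi.symm⟩) fun h => ⟨h, hj.symm⟩⟩
  have h2 : (graphOf ω).neighborSet i ∩ (graphOf ω).neighborSet j =
      (({i, j}ᶜ : Finset V).filter fun x =>
        ω s(i, x) = true ∧ ω s(j, x) = true : Finset V) := by
    ext x
    simp only [Set.mem_inter_iff, SimpleGraph.mem_neighborSet, graphOf_adj, Finset.coe_filter,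
      mem_compl_pair, Set.mem_ofPred_eq]
    constructor
    · rintro ⟨⟨hi, hix⟩, hj, hjx⟩
      exact ⟨⟨hix.symm, hjx.symm⟩, hi, hj⟩
    · rintro ⟨⟨hix, hjx⟩, hi, hj⟩
      exact ⟨⟨hi, hix.symm⟩, hj, hjx.symm⟩
  rw [jaccardIndex, h1, h2, Set.ncard_coe_finset, Set.ncard_coe_finset]
  rfl

theorem sum_sum_offDiag_eq {n : ℕ} {f : Fin n → Fin n → ℝ} (hf : ∀ i j, f i j = f j i) :
    ∑ i, ∑ j, (if i = j then 0 else f i j) = 2 * ∑ i, ∑ j ∈ Finset.Ioi i, f i j := by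
  have h : ∀ i j : Fin n, (if i = j then 0 else f i j) =
      (if i < j then f i j else 0) + if j < i then f j i else 0 := by
    intro i j
    rcases lt_trichotomy i j with h | h | h
    · simp [h, h.ne, h.le]
    · simp [h]
    · simp [h, h.ne', h.le, hf i j]
  have hI : ∀ i : Fin n, ∑ j ∈ Finset.Ioi i, f i j = ∑ j, if i < j then f i j else 0 := fun i => by
    rw [← Finset.sum_filter]
    congr 1
    ext j
    simp
  simp only [h, hI, Finset.sum_add_distrib]
  rw [Finset.sum_comm (f := fun i j : Fin n => if j < i then f j i else 0)]
  ring

theorem averageJaccard_graphOf (n : ℕ) (p : ℝ) (ω : Sym2 (Fin n) → Bool) :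
    averageJaccard n p (graphOf ω) =
      1 / ((n : ℝ) * ((n : ℝ) - 1)) * totalJaccard (p / (2 - p)) ω := by
  have h : ∀ i : Fin n, ∀ j ∈ Finset.Ioi i, jaccardIndex p (graphOf ω) i j =
      bitJaccard (p / (2 - p)) i j ω := fun i j _ =>
    jaccardIndex_graphOf p i j ω
  rw [averageJaccard, Finset.sum_congr rfl fun i _ => Finset.sum_congr rfl (h i), totalJaccard,
    sum_sum_offDiag_eq fun i j => bitJaccard_comm _ i j ω]
  ring

end RandomGraph

/-! ### Normalisation and passage to the limit. -/

section Limit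

/-- The normalised deviation of the average Jaccard index from its mean. -/
def normalizedJaccard (n : ℕ) (p : ℝ) (G : SimpleGraph (Fin n)) : ℝ :=
  (n : ℝ) * (2 - p) ^ 2 / √(8 * p * (1 - p)) * (averageJaccard n p G - p / (2 - p))

/-- The coefficient of the centred edge indicators in the linear approximation. -/
def linearCoeff (n : ℕ) (p : ℝ) : ℝ :=
  (n : ℝ) * (2 - p) ^ 2 / √(8 * p * (1 - p)) * (1 / ((n : ℝ) * ((n : ℝ) - 1)) * meanStep n p)

/-- The normalisation cancels p(1-p)n² in the L² bound up to n²/(n-1)² ≤ 4 and (2-p)⁴ ≤ 16, leaving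
a multiple of 1/K. -/
theorem bernExp_normalizedJaccard_sub_sq_le {n : ℕ} {p : ℝ} (hn : 6 ≤ n) (h0 : 0 < p) (h1 : p < 1)
    (hK : 1 ≤ ((n : ℝ) - 3) * p) :
    bernExp p (fun ω : Sym2 (Fin n) → Bool => (normalizedJaccard n p (graphOf ω) -
      linearCoeff n p * ∑ e ∈ offDiag (Fin n), (bit ω e - p)) ^ 2) ≤
      384000000 / (((n : ℝ) - 3) * p) := by
  set K : ℝ := ((n : ℝ) - 3) * p with hKdef
  have hn' : (6 : ℝ) ≤ n := by exact_mod_cast hn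
  have h2p : 0 < 2 - p := by linarith
  have hμ : p / (2 - p) * (2 - p) = p := div_mul_cancel₀ _ h2p.ne'
  have hμ0 : 0 ≤ p / (2 - p) := by positivity
  have hμ1 : p / (2 - p) ≤ p := div_le_self h0.le (by linarith)
  have h := bernExp_totalJaccard_sub_linear_sq_le (V := Fin n) h0.le h1.le hμ0 hμ1 hμ hK
    (by rw [Fintype.card_fin]) (by rwa [Fintype.card_fin])
  rw [Fintype.card_fin] at h
  have hs : 0 < 8 * p * (1 - p) := by
    have : 0 < 1 - p := by linarith
    positivity
  have hn1 : (0 : ℝ) < (n : ℝ) - 1 := by linarith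
  obtain ⟨r, hr⟩ : ∃ r, r = (n : ℝ) * (2 - p) ^ 2 / √(8 * p * (1 - p)) *
    (1 / ((n : ℝ) * ((n : ℝ) - 1))) := ⟨_, rfl⟩
  have hr2 : r ^ 2 = (2 - p) ^ 4 / (8 * p * (1 - p) * ((n : ℝ) - 1) ^ 2) := by
    rw [hr, mul_pow, div_pow, Real.sq_sqrt hs.le]
    have : (1 - p) ≠ 0 := by linarith
    field_simp
  have e : ∀ ω : Sym2 (Fin n) → Bool, (normalizedJaccard n p (graphOf ω) -
      linearCoeff n p * ∑ e ∈ offDiag (Fin n), (bit ω e - p)) ^ 2 =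
      r ^ 2 * (totalJaccard (p / (2 - p)) ω - n * (n - 1) * (p / (2 - p)) -
        meanStep n p * ∑ e ∈ offDiag (Fin n), (bit ω e - p)) ^ 2 := by
    intro ω
    rw [← mul_pow, normalizedJaccard, averageJaccard_graphOf, linearCoeff, hr]
    congr 1
    have hnn : (n : ℝ) * ((n : ℝ) - 1) ≠ 0 := by positivity
    have : p / (2 - p) = 1 / ((n : ℝ) * ((n : ℝ) - 1)) *
        ((n : ℝ) * ((n : ℝ) - 1) * (p / (2 - p))) := by
      rw [← mul_assoc, one_div, inv_mul_cancel₀ hnn, one_mul]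
    nth_rewrite 2 [this]
    ring
  simp only [e]
  rw [bernExp_const_mul]
  have h4 : (2 - p) ^ 4 ≤ 16 := by
    calc (2 - p) ^ 4 ≤ 2 ^ 4 := by gcongr; linarith
      _ = 16 := by norm_num
  have hq : (1 - p) ≠ 0 := by linarith
  have hK0 : 0 < K := by linarith
  calc r ^ 2 * _ ≤ r ^ 2 * (p * (1 - p) * (n : ℝ) ^ 2 * (48000000 / K)) :=
        mul_le_mul_of_nonneg_left h (sq_nonneg r)
    _ = (2 - p) ^ 4 * ((n : ℝ) ^ 2 / ((n : ℝ) - 1) ^ 2) * (6000000 / K) := by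
        rw [hr2]
        field_simp
        ring
    _ ≤ 16 * 4 * (6000000 / K) := by
        gcongr
        rw [div_le_iff₀ (by positivity)]
        nlinarith
    _ = 384000000 / K := by ring

variable {p : ℕ → ℝ}

/-- For p ≤ 1/2 the quantity is at least np/2, and otherwise at least n²(1-p)/2. -/
theorem tendsto_sq_mul_variance (h0 : ∀ n, 0 ≤ p n) (h1 : ∀ n, p n ≤ 1)
    (hp : Tendsto (fun n : ℕ => (n : ℝ) * p n) atTop atTop)
    (hq : Tendsto (fun n : ℕ => (n : ℝ) ^ 2 * (1 - p n)) atTop atTop) :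
    Tendsto (fun n : ℕ => (n : ℝ) ^ 2 * (p n * (1 - p n))) atTop atTop := by
  rw [tendsto_atTop] at hp hq ⊢
  intro b
  filter_upwards [hp (2 * b), hq (2 * b), eventually_ge_atTop 1] with n hpn hqn hn
  have hn' : (1 : ℝ) ≤ n := by exact_mod_cast hn
  have h0n := h0 n
  have h1n := h1 n
  have hq0 : 0 ≤ 1 - p n := by linarith
  rcases le_total (p n) (1 / 2) with h | h
  · have ha : (n : ℝ) * p n ≤ (n : ℝ) ^ 2 * p n := by nlinarith [mul_nonneg h0n (by linarith : (0 : ℝ) ≤ n)]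
    have hb : (n : ℝ) ^ 2 * p n * (1 / 2) ≤ (n : ℝ) ^ 2 * p n * (1 - p n) :=
      mul_le_mul_of_nonneg_left (by linarith) (by positivity)
    linarith
  · have hb : (n : ℝ) ^ 2 * (1 - p n) * (1 / 2) ≤ (n : ℝ) ^ 2 * (1 - p n) * p n :=
      mul_le_mul_of_nonneg_left h (by positivity)
    linarith

theorem tendsto_one_sub_pow (h0 : ∀ n, 0 ≤ p n) (h1 : ∀ n, p n ≤ 1)
    (hp : Tendsto (fun n : ℕ => (n : ℝ) * p n) atTop atTop) :
    Tendsto (fun n : ℕ => (1 - p n) ^ (2 * (n - 2))) atTop (𝓝 0) := by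
  have hexp : Tendsto (fun n : ℕ => Real.exp (-((n : ℝ) * p n))) atTop (𝓝 0) :=
    Real.tendsto_exp_neg_atTop_nhds_zero.comp hp
  refine squeeze_zero' (Eventually.of_forall fun n => pow_nonneg (by linarith [h1 n]) _) ?_ hexp
  -- n ≥ 4 gives 2(n-2) ≥ n.
  filter_upwards [eventually_ge_atTop 4] with n hn
  calc (1 - p n) ^ (2 * (n - 2)) ≤ (1 - p n) ^ n :=
        pow_le_pow_of_le_one (by linarith [h1 n]) (by linarith [h0 n]) (by omega)
    _ ≤ Real.exp (-p n) ^ n :=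
        pow_le_pow_left₀ (by linarith [h1 n]) (Real.one_sub_le_exp_neg _) _
    _ = Real.exp (-((n : ℝ) * p n)) := by
        rw [← Real.exp_nat_mul]
        ring_nf

/-- This identity explains the normalising constant: multiplied by n(n-1)/2 edges, the right side
becomes (1-(1-p)^(2(n-2)))² n/(n-1), which tends to 1. -/
theorem linearCoeff_sq {n : ℕ} {p : ℝ} (hn : 2 ≤ n) (h0 : 0 < p) (h1 : p < 1) :
    p * (1 - p) * linearCoeff n p ^ 2 =
      2 * (1 - (1 - p) ^ (2 * (n - 2))) ^ 2 / ((n : ℝ) - 1) ^ 2 := by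
  have hq : 0 < 1 - p := by linarith
  have hs : 0 < 8 * p * (1 - p) := by positivity
  have h2 : (2 - p) ≠ 0 := by linarith
  have hn' : (2 : ℝ) ≤ n := by exact_mod_cast hn
  have hn1 : (n : ℝ) - 1 ≠ 0 := by linarith
  rw [linearCoeff, meanStep, mul_pow, div_pow, Real.sq_sqrt hs.le]
  field_simp
  ring

theorem tendsto_div_sub_one : Tendsto (fun n : ℕ => (n : ℝ) / ((n : ℝ) - 1)) atTop (𝓝 1) := by
  have h : Tendsto (fun n : ℕ => 1 + 1 / ((n : ℝ) - 1)) atTop (𝓝 (1 + 0)) := by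
    refine tendsto_const_nhds.add ?_
    simp only [one_div]
    exact tendsto_inv_atTop_zero.comp
      (tendsto_atTop_add_const_right _ (-1) tendsto_natCast_atTop_atTop)
  rw [add_zero] at h
  refine h.congr' ?_
  filter_upwards [eventually_ge_atTop 2] with n hn
  have hn' : (2 : ℝ) ≤ n := by exact_mod_cast hn
  have hn1 : (n : ℝ) - 1 ≠ 0 := by linarith
  field_simp
  ring

/-- Excludes p = 0 and p = 1, where the square root in the normalisation vanishes. -/
theorem eventually_mem_Ioo (h0 : ∀ n, 0 ≤ p n) (h1 : ∀ n, p n ≤ 1)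
    (hp : Tendsto (fun n : ℕ => (n : ℝ) * p n) atTop atTop)
    (hq : Tendsto (fun n : ℕ => (n : ℝ) ^ 2 * (1 - p n)) atTop atTop) :
    ∀ᶠ n in atTop, 0 < p n ∧ p n < 1 := by
  filter_upwards [hp.eventually_gt_atTop 0, hq.eventually_gt_atTop 0] with n hpn hqn
  refine ⟨lt_of_le_of_ne (h0 n) fun h => ?_, lt_of_le_of_ne (h1 n) fun h => ?_⟩
  · rw [← h, mul_zero] at hpn
    exact lt_irrefl _ hpn
  · rw [h, sub_self, mul_zero] at hqn
    exact lt_irrefl _ hqn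

theorem tendsto_card_mul_variance_mul_sq (h0 : ∀ n, 0 ≤ p n) (h1 : ∀ n, p n ≤ 1)
    (hp : Tendsto (fun n : ℕ => (n : ℝ) * p n) atTop atTop)
    (hq : Tendsto (fun n : ℕ => (n : ℝ) ^ 2 * (1 - p n)) atTop atTop) (t : ℝ) :
    Tendsto (fun n : ℕ => ((offDiag (Fin n)).card : ℝ) *
      (p n * (1 - p n) * (t * linearCoeff n (p n)) ^ 2)) atTop (𝓝 (t ^ 2)) := by
  have hlim : Tendsto (fun n : ℕ => t ^ 2 * (1 - (1 - p n) ^ (2 * (n - 2))) ^ 2 *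
      ((n : ℝ) / ((n : ℝ) - 1))) atTop (𝓝 (t ^ 2 * (1 - 0) ^ 2 * 1)) :=
    (((tendsto_const_nhds.sub (tendsto_one_sub_pow h0 h1 hp)).pow 2).const_mul (t ^ 2)).mul
      tendsto_div_sub_one
  rw [sub_zero, one_pow, mul_one, mul_one] at hlim
  refine hlim.congr' ?_
  filter_upwards [eventually_mem_Ioo h0 h1 hp hq, eventually_ge_atTop 2] with n hpn hn
  have hn' : (2 : ℝ) ≤ n := by exact_mod_cast hn
  have hn1 : (n : ℝ) - 1 ≠ 0 := by linarith
  have h := linearCoeff_sq hn hpn.1 hpn.2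
  rw [card_offDiag, Fintype.card_fin, Nat.cast_choose_two,
    show p n * (1 - p n) * (t * linearCoeff n (p n)) ^ 2 =
      t ^ 2 * (p n * (1 - p n) * linearCoeff n (p n) ^ 2) by ring, h]
  field_simp

/-- The squared coefficient is at most 8/(n²p(1-p)), so no single edge matters in the limit. -/
theorem tendsto_linearCoeff (h0 : ∀ n, 0 ≤ p n) (h1 : ∀ n, p n ≤ 1)
    (hp : Tendsto (fun n : ℕ => (n : ℝ) * p n) atTop atTop)
    (hq : Tendsto (fun n : ℕ => (n : ℝ) ^ 2 * (1 - p n)) atTop atTop) :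
    Tendsto (fun n : ℕ => linearCoeff n (p n)) atTop (𝓝 0) := by
  have hv := tendsto_sq_mul_variance h0 h1 hp hq
  have hsq : Tendsto (fun n : ℕ => linearCoeff n (p n) ^ 2) atTop (𝓝 0) := by
    refine squeeze_zero' (Eventually.of_forall fun n => sq_nonneg _) ?_
      ((tendsto_inv_atTop_zero.comp hv).const_mul 8 |>.trans_eq (by simp))
    filter_upwards [eventually_mem_Ioo h0 h1 hp hq, eventually_ge_atTop 2] with n hpn hn
    have hn' : (2 : ℝ) ≤ n := by exact_mod_cast hn
    have hn1 : (0 : ℝ) < (n : ℝ) - 1 := by linarith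
    have h := linearCoeff_sq hn hpn.1 hpn.2
    have hq : 0 < 1 - p n := by linarith [hpn.2]
    have hpq : 0 < p n * (1 - p n) := mul_pos hpn.1 hq
    have hδ0 : 0 ≤ (1 - p n) ^ (2 * (n - 2)) := pow_nonneg hq.le _
    have hδ1 : (1 - p n) ^ (2 * (n - 2)) ≤ 1 := pow_le_one₀ hq.le (by linarith [hpn.1])
    have hle : (1 - (1 - p n) ^ (2 * (n - 2))) ^ 2 ≤ 1 := by nlinarith
    have hkey : p n * (1 - p n) * linearCoeff n (p n) ^ 2 ≤ 8 / (n : ℝ) ^ 2 := by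
      rw [h, div_le_div_iff₀ (by positivity) (by positivity)]
      nlinarith [mul_le_mul_of_nonneg_right hle (sq_nonneg (n : ℝ))]
    simp only [Function.comp_apply]
    rw [← div_eq_mul_inv, le_div_iff₀ (by positivity)]
    rw [le_div_iff₀ (by positivity)] at hkey
    linarith
  have habs := (Real.continuous_sqrt.tendsto 0).comp hsq
  rw [Real.sqrt_zero] at habs
  refine (tendsto_zero_iff_abs_tendsto_zero _).2 (habs.congr fun n => ?_)
  simp [Real.sqrt_sq_eq_abs]

theorem tendsto_sum_bernWeight_exp_normalizedJaccard (h0 : ∀ n, 0 ≤ p n) (h1 : ∀ n, p n ≤ 1)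
    (hp : Tendsto (fun n : ℕ => (n : ℝ) * p n) atTop atTop)
    (hq : Tendsto (fun n : ℕ => (n : ℝ) ^ 2 * (1 - p n)) atTop atTop) (t : ℝ) :
    Tendsto (fun n : ℕ => ∑ ω : Sym2 (Fin n) → Bool, (bernWeight (p n) ω : ℂ) *
      Complex.exp ((t * normalizedJaccard n (p n) (graphOf ω) : ℝ) * Complex.I)) atTop
      (𝓝 ((Real.exp (-(t ^ 2 / 2)) : ℝ) : ℂ)) := by
  have hlin : Tendsto (fun n : ℕ => ∑ ω : Sym2 (Fin n) → Bool, (bernWeight (p n) ω : ℂ) *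
      Complex.exp ((t * (linearCoeff n (p n) * ∑ e ∈ offDiag (Fin n), (bit ω e - p n)) : ℝ) *
        Complex.I)) atTop (𝓝 ((Real.exp (-(t ^ 2 / 2)) : ℝ) : ℂ)) := by
    have hθ : Tendsto (fun n : ℕ => t * linearCoeff n (p n)) atTop (𝓝 0) := by
      simpa using (tendsto_linearCoeff h0 h1 hp hq).const_mul t
    refine (tendsto_bernChar_pow h0 h1 hθ
      (tendsto_card_mul_variance_mul_sq h0 h1 hp hq t)).congr fun n => ?_
    rw [← sum_bernWeight_mul_exp]
    simp only [mul_assoc]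
  -- Losing three vertices costs at most 3, since p ≤ 1.
  have hK : Tendsto (fun n : ℕ => ((n : ℝ) - 3) * p n) atTop atTop := by
    rw [tendsto_atTop] at hp ⊢
    intro b
    filter_upwards [hp (b + 3)] with n hn
    nlinarith [h1 n]
  have hbound : Tendsto (fun n : ℕ => |t| * √(384000000 / (((n : ℝ) - 3) * p n))) atTop (𝓝 0) := by
    have h := (Real.continuous_sqrt.tendsto 0).comp
      ((tendsto_inv_atTop_zero.comp hK).const_mul 384000000 |>.trans_eq (by simp))
    rw [Real.sqrt_zero] at h
    simpa [div_eq_mul_inv, Function.comp_def] using h.const_mul |t|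
  have hdiff : Tendsto (fun n : ℕ => ∑ ω : Sym2 (Fin n) → Bool, (bernWeight (p n) ω : ℂ) *
      Complex.exp ((t * normalizedJaccard n (p n) (graphOf ω) : ℝ) * Complex.I) -
      ∑ ω : Sym2 (Fin n) → Bool, (bernWeight (p n) ω : ℂ) *
      Complex.exp ((t * (linearCoeff n (p n) * ∑ e ∈ offDiag (Fin n), (bit ω e - p n)) : ℝ) *
        Complex.I)) atTop (𝓝 0) := by
    refine squeeze_zero_norm' ?_ hbound
    filter_upwards [eventually_mem_Ioo h0 h1 hp hq, eventually_ge_atTop 6,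
      hK.eventually_ge_atTop 1] with n hpn hn hKn
    refine (norm_sum_bernWeight_exp_sub_le (h0 n) (h1 n) _ _ t).trans ?_
    refine mul_le_mul_of_nonneg_left (Real.sqrt_le_sqrt ?_) (abs_nonneg t)
    exact bernExp_normalizedJaccard_sub_sq_le hn hpn.1 hpn.2 hKn
  simpa using hdiff.add hlin

end Limit

end

theorem theorem3p1 {Ω' : Type*} [MeasurableSpace Ω'] (P' : Measure Ω') [IsProbabilityMeasure P']
    (Z : Ω' → ℝ) (hZ : HasLaw Z (gaussianReal 0 1) P')
    (p : ℕ → I)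
    (hp : Tendsto (fun n : ℕ => (n : ℝ) * (p n : ℝ)) atTop atTop)
    (hq : Tendsto (fun n : ℕ => (n : ℝ) ^ 2 * (1 - (p n : ℝ))) atTop atTop) :
    TendstoInDistribution
      (fun (n : ℕ) (G : SimpleGraph (Fin n)) =>
        (n : ℝ) * (2 - (p n : ℝ)) ^ 2 / √(8 * (p n : ℝ) * (1 - (p n : ℝ))) *
          (averageJaccard n (p n : ℝ) G - (p n : ℝ) / (2 - (p n : ℝ))))
      atTop Z (fun n : ℕ => SimpleGraph.binomialRandom (Fin n) (p n)) P' := by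
  have hmeas : ∀ n : ℕ, AEMeasurable (normalizedJaccard n (p n))
      (SimpleGraph.binomialRandom (Fin n) (p n)) := fun n => by
    have := measurableSingletonClass_simpleGraph (Fin n)
    exact (measurable_of_finite _).aemeasurable
  refine ⟨hmeas, hZ.aemeasurable, ?_⟩
  -- Lévy's continuity theorem reduces the claim to pointwise convergence of characteristic
  -- functions.
  refine ProbabilityMeasure.tendsto_iff_tendsto_charFun.2 fun t => ?_
  have h := tendsto_sum_bernWeight_exp_normalizedJaccard (p := fun n => (p n : ℝ))
    (fun n => (p n).2.1) (fun n => (p n).2.2) hp hq t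
  have hlim : charFun (P'.map Z) t = ((Real.exp (-(t ^ 2 / 2)) : ℝ) : ℂ) := by
    rw [hZ.map_eq, charFun_gaussianReal]
    push_cast
    congr 1
    simp
  change Tendsto (fun n : ℕ => charFun
    ((SimpleGraph.binomialRandom (Fin n) (p n)).map (normalizedJaccard n (p n))) t) atTop
    (𝓝 (charFun (P'.map Z) t))
  rw [hlim]
  refine h.congr fun n => ?_
  rw [charFun_apply_real, integral_map (hmeas n) (by fun_prop), integral_binomialRandom]
  simp
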